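/- Let $\mathcal H_1,\mathcal H_2$ be complex Hilbert spaces, $T$ a (possibly unbounded) self-adjoint operator in $\mathcal H_1$ with spectrum $\sigma(T)\subseteq\mathbb R$ and spectral measure $E_T$, let $V:\mathcal H_2\to\mathcal H_1$ be a bounded linear operator, and let $\lambda\in\mathbb C\setminus\mathbb R$. Let $\sigma_V(T)\subseteq\sigma(T)$ denote the support of the positive operator-valued measure $V^*E_T(\cdot)V$, that is, the set of all $t\in\mathbb R$ such that $V^*E_T(U)V\neq 0$ for every open neighbourhood $U$ of $t$. For a closed set $M\subseteq\mathbb R$ let $C^+(M)$ be the set of all continuous functions $f:M\to(0,\infty)$ with $\sup_{t\in M}f(t)<\infty$ and $\inf_{t\in M,\,|t|\ge 1}|t|f(t)>0$ (where the supremum condition and the infimum condition count as satisfied if the set of admissible $t$ is empty). For $f\in C^+(\sigma(T))$ put $f(T)=\int_{\sigma(T)}f\,dE_T$, a bounded operator in $\mathcal H_1$. For $t\in\mathbb R$ and $r\ge 0$ let $\mathcal B_r(t)=\{z\in\mathbb C:|z-t|\le r\}$. Then the following statements are equivalent: (a) $\|(T-\lambda)^{-1}V\|\ge 1$; (b) for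 all $f\in C^+(\sigma(T))$ one has $$\lambda\in\bigcup_{t\in\sigma_V(T)}\mathcal B_{f(t)^{-1}\|f(T)V\|}(t).$$ -/

import Mathlib

open MeasureTheory Set

noncomputable section

/-! ### Resolvent and spectrum of an unbounded operator -/

section Resolvent

variable {H : Type*} [NormedAddCommGroup H] [InnerProductSpace ℂ H]

/-- `R` is a bounded two-sided inverse of `T - z : dom T → H`. -/
def IsResolventAt (T : H →ₗ.[ℂ] H) (z : ℂ) (R : H →L[ℂ] H) : Prop :=
  (∀ x : T.domain, R (T x - z • (x : H)) = x) ∧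
    ∀ y : H, ∃ h : R y ∈ T.domain, T ⟨R y, h⟩ - z • R y = y

/-- A resolvent is uniquely determined. -/
theorem IsResolventAt.unique {T : H →ₗ.[ℂ] H} {z : ℂ} {R R' : H →L[ℂ] H}
    (h : IsResolventAt T z R) (h' : IsResolventAt T z R') : R = R' := by
  ext y
  obtain ⟨hy, e⟩ := h'.2 y
  have := h.1 ⟨R' y, hy⟩
  rwa [e] at this

/-- The spectrum of `T`: all `z` for which `T - z` has no bounded everywhere defined inverse. -/
def unboundedSpectrum (T : H →ₗ.[ℂ] H) : Set ℂ :=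
  {z | ¬ ∃ R : H →L[ℂ] H, IsResolventAt T z R}

/-- The real points of the spectrum. This is the whole spectrum if `T` is self-adjoint. -/
def realSpectrum (T : H →ₗ.[ℂ] H) : Set ℝ :=
  {t | (t : ℂ) ∈ unboundedSpectrum T}

open Classical in
/-- The resolvent operator `(T - z)⁻¹` (and `0` if `z` belongs to the spectrum). -/
def resolventOp (T : H →ₗ.[ℂ] H) (z : ℂ) : H →L[ℂ] H :=
  if h : ∃ R : H →L[ℂ] H, IsResolventAt T z R then h.choose else 0

end Resolvent

/-! ### Projection-valued measures -/

/-- A projection-valued measure on the Borel sets of `ℝ`: its values are orthogonal projections,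
and it is countably additive in the strong operator topology. The values on sets that are not
Borel are irrelevant. -/
structure ProjValuedMeasure (H : Type*) [NormedAddCommGroup H] [InnerProductSpace ℂ H]
    [CompleteSpace H] where
  /-- The projection attached to a Borel set. -/
  proj : Set ℝ → H →L[ℂ] H
  isStarProjection_proj : ∀ S, MeasurableSet S → IsStarProjection (proj S)
  proj_empty : proj ∅ = 0
  proj_univ : proj univ = 1
  proj_inter : ∀ S S', MeasurableSet S → MeasurableSet S' → proj (S ∩ S') = proj S * proj S'
  hasSum_proj : ∀ S : ℕ → Set ℝ, (∀ n, MeasurableSet (S n)) →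
    Pairwise (fun m n => Disjoint (S m) (S n)) →
    ∀ x : H, HasSum (fun n => proj (S n) x) (proj (⋃ n, S n) x)

namespace ProjValuedMeasure

variable {H : Type*} [NormedAddCommGroup H] [InnerProductSpace ℂ H] [CompleteSpace H]

theorem inner_proj (P : ProjValuedMeasure H) {S : Set ℝ} (hS : MeasurableSet S) (x : H) :
    inner ℂ x (P.proj S x) = ((‖P.proj S x‖ ^ 2 : ℝ) : ℂ) := by
  have hp := P.isStarProjection_proj S hS
  have h1 : P.proj S (P.proj S x) = P.proj S x := by
    have := congrArg (fun A : H →L[ℂ] H => A x) hp.isIdempotentElem.eq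
    simpa using this
  have h2 := ContinuousLinearMap.adjoint_inner_left (P.proj S) (P.proj S x) x
  rw [← ContinuousLinearMap.star_eq_adjoint, hp.isSelfAdjoint.star_eq, h1] at h2
  rw [← h2, inner_self_eq_norm_sq_to_K]
  push_cast
  rfl

/-- The finite Borel measure `S ↦ ‖E(S) x‖² = ⟪x, E(S) x⟫`. -/
def scalar (P : ProjValuedMeasure H) (x : H) : Measure ℝ :=
  Measure.ofMeasurable (fun S _ => ENNReal.ofReal (‖P.proj S x‖ ^ 2))
    (by simp [P.proj_empty])
    (by
      intro S hS hd
      have h := (P.hasSum_proj S hS hd x).mapL (innerSL ℂ x)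
      simp only [innerSL_apply_apply, P.inner_proj (hS _),
        P.inner_proj (MeasurableSet.iUnion hS)] at h
      have h' : HasSum (fun n => ‖P.proj (S n) x‖ ^ 2) (‖P.proj (⋃ n, S n) x‖ ^ 2) := by
        exact_mod_cast h
      rw [← h'.tsum_eq]
      exact ENNReal.ofReal_tsum_of_nonneg (fun n => by positivity) h'.summable)

theorem scalar_apply (P : ProjValuedMeasure H) (x : H) {S : Set ℝ} (hS : MeasurableSet S) :
    P.scalar x S = ENNReal.ofReal (‖P.proj S x‖ ^ 2) :=
  Measure.ofMeasurable_apply S hS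

/-- `P` is a spectral measure of `T`, i.e. `T = ∫ t dP(t)`: the domain of `T` consists of the
vectors `x` with `∫ t² d⟪x, P(t) x⟫ < ∞`, and `⟪x, T x⟫ = ∫ t d⟪x, P(t) x⟫` for these `x`
(by polarization, this determines `T`). -/
def IsSpectralMeasureOf (P : ProjValuedMeasure H) (T : H →ₗ.[ℂ] H) : Prop :=
  (∀ x : H, x ∈ T.domain ↔ Integrable (fun t : ℝ => t ^ 2) (P.scalar x)) ∧
    ∀ x : T.domain, inner ℂ (x : H) (T x) = ((∫ t, t ∂(P.scalar (x : H)) : ℝ) : ℂ)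

open Classical in
/-- The unit mass at a point, with values `0` and `1`. -/
def dirac (a : ℝ) : ProjValuedMeasure H where
  proj S := if a ∈ S then 1 else 0
  isStarProjection_proj S _ := by
    split_ifs
    · exact IsStarProjection.one _
    · exact IsStarProjection.zero _
  proj_empty := by simp
  proj_univ := by simp
  proj_inter S S' _ _ := by
    by_cases h : a ∈ S <;> by_cases h' : a ∈ S' <;> simp [h, h']
  hasSum_proj S _ hd x := by
    by_cases h : ∃ n, a ∈ S n
    · obtain ⟨n, hn⟩ := h
      have hu : a ∈ ⋃ n, S n := mem_iUnion.2 ⟨n, hn⟩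
      have key : ∀ m, m ≠ n → (if a ∈ S m then (1 : H →L[ℂ] H) else 0) x = 0 := by
        intro m hm
        have : a ∉ S m := fun hm' => Set.disjoint_left.1 (hd hm) hm' hn
        simp [this]
      have := hasSum_single n key
      simpa [hn, hu] using this
    · have hu : a ∉ ⋃ n, S n := fun hu => h (mem_iUnion.1 hu)
      have hn : ∀ n, a ∉ S n := fun n hn => h ⟨n, hn⟩
      simp [hu, hn, hasSum_zero]

end ProjValuedMeasure

/-! ### Spectral measure and functional calculus of a self-adjoint operator -/

section SelfAdjoint

variable {H : Type*} [NormedAddCommGroup H] [InnerProductSpace ℂ H] [CompleteSpace H]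

open Classical in
/-- The spectral measure `E_T` of `T`, i.e. the projection-valued measure with `T = ∫ t dE_T(t)`.
(If `T` has none, which does not happen for a self-adjoint `T`, the value is arbitrary.) -/
def spectralMeasure (T : H →ₗ.[ℂ] H) : ProjValuedMeasure H :=
  if h : ∃ P : ProjValuedMeasure H, P.IsSpectralMeasureOf T then h.choose
  else ProjValuedMeasure.dirac 0

/-- The bounded operator `A` is `f(T) = ∫_{σ(T)} f dE_T` in the weak sense:
`⟪x, A x⟫ = ∫_{σ(T)} f(t) d⟪x, E_T(t) x⟫` for all `x`. -/
def IsFunctionOf (T : H →ₗ.[ℂ] H) (f : ℝ → ℝ) (A : H →L[ℂ] H) : Prop :=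
  ∀ x : H, IntegrableOn f (realSpectrum T) ((spectralMeasure T).scalar x) ∧
    inner ℂ x (A x) = ((∫ t in realSpectrum T, f t ∂((spectralMeasure T).scalar x) : ℝ) : ℂ)

/-- The operator `f(T)` is uniquely determined by its quadratic form. -/
theorem IsFunctionOf.unique {T : H →ₗ.[ℂ] H} {f : ℝ → ℝ} {A B : H →L[ℂ] H}
    (hA : IsFunctionOf T f A) (hB : IsFunctionOf T f B) : A = B := by
  have h : (A : H →ₗ[ℂ] H) = (B : H →ₗ[ℂ] H) := by
    refine (ext_inner_map _ _).1 fun x => ?_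
    rw [← inner_conj_symm, ← inner_conj_symm ((B : H →ₗ[ℂ] H) x)]
    exact congrArg _ ((hA x).2.trans (hB x).2.symm)
  ext x
  exact congrArg (fun L : H →ₗ[ℂ] H => L x) h

open Classical in
/-- The bounded operator `f(T)`, for a function `f` that is continuous and bounded on the spectrum
of the self-adjoint operator `T`. Values of `f` outside the spectrum do not matter.
(If no bounded operator satisfies the defining relation, the value is `0`.) -/
def functionOf (T : H →ₗ.[ℂ] H) (f : ℝ → ℝ) : H →L[ℂ] H :=
  if h : ∃ A : H →L[ℂ] H, IsFunctionOf T f A then h.choose else 0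

/-- The set `σ_V(T)`: the support of the positive operator-valued measure `V* E_T(·) V`. -/
def spectrumAlong {K : Type*} [NormedAddCommGroup K] [InnerProductSpace ℂ K] [CompleteSpace K]
    (T : H →ₗ.[ℂ] H) (V : K →L[ℂ] H) : Set ℝ :=
  {t | ∀ U : Set ℝ, IsOpen U → t ∈ U →
    (ContinuousLinearMap.adjoint V) ∘L ((spectralMeasure T).proj U) ∘L V ≠ 0}

end SelfAdjoint

/-- The class `C⁺(M)`: functions that are continuous, positive and bounded on `M`, and for which
`|t| f(t)` is bounded away from zero on `{t ∈ M : |t| ≥ 1}`. -/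
def ContPlus (M : Set ℝ) : Set (ℝ → ℝ) :=
  {f | ContinuousOn f M ∧ (∀ t ∈ M, 0 < f t) ∧ BddAbove (f '' M) ∧
    ∃ c : ℝ, 0 < c ∧ ∀ t ∈ M, 1 ≤ |t| → c ≤ |t| * f t}

end

/-!
The two norms in the statement are integrals: if `μ_y` denotes the measure `S ↦ ‖E_T(S) y‖²`, then
`‖(T - λ)⁻¹ y‖² = ∫ |t - λ|⁻² dμ_y` and `‖f(T) y‖² = ∫ f² dμ_y`, and for `y = V x` the measure `μ_y`
lives on `σ_V(T)` (`norm_resolventOp_sq`, `norm_functionOf_sq`, `ae_mem_spectrumAlong`).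

If the inclusion holds for all `f`, apply it to `f(t) = |t - λ|⁻¹`, for which
`‖f(T) V‖ = ‖(T - λ)⁻¹ V‖`: some ball of radius `|t - λ| ‖(T - λ)⁻¹ V‖` about `t` contains `λ`.
Conversely, if `λ` avoids all balls for some `f`, then `n |t - λ|⁻¹ < f(t)` on `σ_V(T)`, where
`n = ‖f(T) V‖`. Integrating the squares gives `‖(T - λ)⁻¹ V x‖ < ‖x‖`, but the gap between the two
functions may close at infinity and so does not bound the norm at once. It is bounded below on
compact sets, though, and far out `|t - λ|⁻²` is small compared with `‖V‖⁻²`, so that vectors `V x`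
whose mass escapes to infinity do not bring `‖(T - λ)⁻¹ V x‖` near `‖x‖`
(`norm_resolventOp_comp_lt_one`).

The bulk of the file is the spectral theorem behind these formulas. `MeasurableRep` axiomatizes a
`*`-representation of an algebra `A` of bounded functions in which every vector `x` has a measure
`μ_x` with `⟪x, f x⟫ = ∫ f dμ_x`. Since `f ↦ f x` is isometric for the norm of `L²(μ_x)` and `A` is
dense there, it extends to an isometry `g ↦ g x` (`MeasurableRep.vec`). Because `A` is dense in `L²`
of any finite measure, a single element of `A` approximates `g` for several vectors at once, which
gives linearity in `x` and multiplicativity in `g` (`vec_add_left`, `vec_vec`). This is used twice: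
* with the continuous functions on the spectrum of the normal operator `(T + i)⁻¹`, where the
  measures come from the Riesz–Markov–Kakutani theorem, to construct a spectral measure of `T`
  (`IsSelfAdjoint.exists_isSpectralMeasureOf`);
* with the simple functions and an arbitrary spectral measure of `T`, to compute with it
  (`apply_eq_vec`, `op_inv_sub_eq`, `ae_mem_realSpectrum`).
-/

noncomputable section

/-! ### Function algebras acting on a Hilbert space -/

theorem MeasureTheory.MemLp.two_add_measure {α : Type*} [MeasurableSpace α] {μ ν : Measure α}
    {g : α → ℂ} (h : MemLp g 2 μ) (h' : MemLp g 2 ν) : MemLp g 2 (μ + ν) := by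
  have hm : AEStronglyMeasurable g (μ + ν) :=
    aestronglyMeasurable_add_measure_iff.2 ⟨h.1, h'.1⟩
  rw [memLp_two_iff_integrable_sq_norm hm]
  exact ((memLp_two_iff_integrable_sq_norm h.1).1 h).add_measure
    ((memLp_two_iff_integrable_sq_norm h'.1).1 h')

theorem MeasureTheory.eLpNorm_two_sq {α : Type*} [MeasurableSpace α] (μ : Measure α) (g : α → ℂ) :
    eLpNorm g 2 μ ^ 2 = ∫⁻ a, ‖g a‖ₑ ^ 2 ∂μ := by
  have h := eLpNorm_nnreal_pow_eq_lintegral (f := g) (μ := μ) (p := 2) two_ne_zero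
  simpa using h

theorem eq_of_forall_enorm_sub_le {H : Type*} [NormedAddCommGroup H] {x y : H} {C : ENNReal}
    (hC : C ≠ ⊤) (h : ∀ ε : ENNReal, ε ≠ 0 → ‖x - y‖ₑ ≤ C * ε) : x = y := by
  have h0 : ‖x - y‖ₑ ≤ 0 := by
    refine ge_of_tendsto (x := nhdsWithin (0 : ENNReal) (Ioi 0)) (f := fun ε => C * ε) ?_ ?_
    · have := (ENNReal.continuous_const_mul hC).tendsto 0
      rw [mul_zero] at this
      exact this.mono_left nhdsWithin_le_nhds
    · filter_upwards [self_mem_nhdsWithin] with ε hε using h ε (ne_of_gt hε)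
  rw [nonpos_iff_eq_zero, enorm_eq_zero, sub_eq_zero] at h0
  exact h0

/-- Bounded measurable complex functions, the functions of which bounded operators `∫ g dE` are
formed. -/
def IsBddMeas {α : Type*} [MeasurableSpace α] (g : α → ℂ) : Prop :=
  Measurable g ∧ ∃ C : ℝ, ∀ a, ‖g a‖ ≤ C

namespace IsBddMeas

variable {α : Type*} [MeasurableSpace α] {g h : α → ℂ}

theorem memLp (hg : IsBddMeas g) (p : ENNReal) (ν : Measure α) [IsFiniteMeasure ν] :
    MemLp g p ν := by
  obtain ⟨hm, C, hC⟩ := hg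
  exact MemLp.of_bound hm.aestronglyMeasurable C (Filter.Eventually.of_forall hC)

theorem memLp_mul (hg : IsBddMeas g) {p : ENNReal} {ν : Measure α} (hh : MemLp h p ν) :
    MemLp (g * h) p ν := by
  obtain ⟨hm, C, hC⟩ := hg
  refine (hh.const_mul (C : ℂ)).mono (hm.aestronglyMeasurable.mul hh.1)
    (Filter.Eventually.of_forall fun a => ?_)
  simp only [Pi.mul_apply, norm_mul, Complex.norm_real]
  gcongr
  exact (hC a).trans (le_abs_self C)

theorem mul (hg : IsBddMeas g) (hh : IsBddMeas h) : IsBddMeas (g * h) := by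
  obtain ⟨hm, C, hC⟩ := hg
  obtain ⟨hm', C', hC'⟩ := hh
  refine ⟨hm.mul hm', C * C', fun a => ?_⟩
  rw [Pi.mul_apply, norm_mul]
  exact mul_le_mul (hC a) (hC' a) (norm_nonneg _) ((norm_nonneg _).trans (hC a))

theorem indicator_one {S : Set α} (hS : MeasurableSet S) :
    IsBddMeas (S.indicator (1 : α → ℂ)) := by
  refine ⟨measurable_one.indicator hS, 1, fun a => ?_⟩
  by_cases ha : a ∈ S <;> simp [ha]

end IsBddMeas

/-- A `*`-algebra `A` of bounded measurable functions on `α` represented on the Hilbert space `H`,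
such that every vector has a scalar spectral measure and `A` is dense in all spaces `L²(ν)`,
`ν` finite. Both `C(X, ℂ)` and the algebra of simple functions are of this kind. -/
structure MeasurableRep (α H A : Type*) [MeasurableSpace α] [NormedAddCommGroup H]
    [InnerProductSpace ℂ H] [CompleteSpace H] [Ring A] [Algebra ℂ A] [StarRing A] where
  /-- The function on `α` that belongs to an element of `A`. -/
  toFn : A →⋆ₐ[ℂ] (α → ℂ)
  /-- The representation of `A`. -/
  rep : A →⋆ₐ[ℂ] (H →L[ℂ] H)
  /-- The scalar spectral measure of a vector. -/
  meas : H → Measure α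
  isFiniteMeasure_meas : ∀ x, IsFiniteMeasure (meas x)
  isBddMeas_toFn : ∀ f, IsBddMeas (toFn f)
  inner_rep : ∀ x f, inner ℂ x (rep f x) = ∫ a, toFn f a ∂(meas x)
  exists_approx : ∀ ν : Measure α, IsFiniteMeasure ν → ∀ g : α → ℂ, MemLp g 2 ν →
    ∀ ε : ENNReal, ε ≠ 0 → ∃ f, eLpNorm (g - toFn f) 2 ν ≤ ε

namespace MeasurableRep

variable {α H A : Type*} [MeasurableSpace α] [NormedAddCommGroup H]
    [InnerProductSpace ℂ H] [CompleteSpace H] [Ring A] [Algebra ℂ A] [StarRing A]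
    (M : MeasurableRep α H A)

instance (x : H) : IsFiniteMeasure (M.meas x) := M.isFiniteMeasure_meas x

theorem memLp_toFn (f : A) (ν : Measure α) [IsFiniteMeasure ν] : MemLp (M.toFn f) 2 ν :=
  (M.isBddMeas_toFn f).memLp 2 ν

/-- The algebra `A` as a subspace of `L²(ν)`. -/
def toL2 (ν : Measure α) [IsFiniteMeasure ν] : A →ₗ[ℂ] Lp ℂ 2 ν where
  toFun f := (M.memLp_toFn f ν).toLp
  map_add' f g := by
    rw [← MemLp.toLp_add]
    congr 1
    exact map_add _ _ _
  map_smul' c f := by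
    rw [RingHom.id_apply, ← MemLp.toLp_const_smul]
    congr 1
    exact map_smul _ _ _

theorem denseRange_toL2 (ν : Measure α) [IsFiniteMeasure ν] : DenseRange (M.toL2 ν) := by
  intro u
  rw [EMetric.mem_closure_iff]
  intro ε hε
  obtain ⟨δ, hδ, hδε⟩ := exists_between hε
  obtain ⟨f, hf⟩ := M.exists_approx ν inferInstance u (Lp.memLp u) δ hδ.ne'
  refine ⟨_, ⟨f, rfl⟩, lt_of_le_of_lt ?_ hδε⟩
  conv_lhs => rw [← Lp.toLp_coeFn u (Lp.memLp u)]
  exact (Lp.edist_toLp_toLp _ _ _ (M.memLp_toFn f ν)).trans_le hf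

/-- The orbit map `f ↦ f x`. -/
def orbit (x : H) : A →ₗ[ℂ] H where
  toFun f := M.rep f x
  map_add' f g := by simp
  map_smul' c f := by simp

theorem norm_orbit (x : H) (f : A) : ‖M.orbit x f‖ = ‖M.toL2 (M.meas x) f‖ := by
  rw [← sq_eq_sq₀ (norm_nonneg _) (norm_nonneg _)]
  have h1 : inner ℂ (M.rep f x) (M.rep f x) = inner ℂ x (M.rep (star f * f) x) := by
    rw [map_mul, map_star, ContinuousLinearMap.star_eq_adjoint, mul_apply_eq_comp,
      ContinuousLinearMap.adjoint_inner_right]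
  have h2 : inner ℂ (M.toL2 (M.meas x) f) (M.toL2 (M.meas x) f)
      = inner ℂ (M.rep f x) (M.rep f x) := by
    rw [h1, M.inner_rep, L2.inner_def]
    refine integral_congr_ae ?_
    filter_upwards [(M.memLp_toFn f (M.meas x)).coeFn_toLp] with a ha
    change inner ℂ (((M.memLp_toFn f (M.meas x)).toLp) a) (((M.memLp_toFn f (M.meas x)).toLp) a) = _
    rw [ha, map_mul, map_star]
    exact mul_comm _ _
  rw [inner_self_eq_norm_sq_to_K, inner_self_eq_norm_sq_to_K] at h2
  exact_mod_cast h2.symm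

/-- The isometry of `L²` with respect to the scalar measure of `x` onto the cyclic subspace of `x`
that extends the orbit map. -/
def cyclic (x : H) : Lp ℂ 2 (M.meas x) →ₗᵢ[ℂ] H where
  toLinearMap := ((M.orbit x).extendOfNorm (M.toL2 (M.meas x))).toLinearMap
  norm_map' u := by
    have hd := M.denseRange_toL2 (M.meas x)
    have hn : ∃ C, ∀ f, ‖M.orbit x f‖ ≤ C * ‖M.toL2 (M.meas x) f‖ :=
      ⟨1, fun f => by rw [one_mul, M.norm_orbit]⟩
    refine hd.induction_on (p := fun u => ‖((M.orbit x).extendOfNorm (M.toL2 (M.meas x))) u‖ = ‖u‖)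
      u (isClosed_eq (by fun_prop) (by fun_prop)) fun f => ?_
    rw [LinearMap.extendOfNorm_eq hd hn, norm_orbit]

theorem cyclic_toL2 (x : H) (f : A) : M.cyclic x (M.toL2 (M.meas x) f) = M.rep f x :=
  LinearMap.extendOfNorm_eq (f := M.orbit x) (M.denseRange_toL2 (M.meas x))
    ⟨1, fun f => by rw [one_mul, M.norm_orbit]⟩ f

open Classical in
/-- The vector `g x = ∫ g dE x` for a function `g` that is square integrable with respect to the
scalar measure of `x` (and `0` for other functions). -/
def vec (x : H) (g : α → ℂ) : H :=
  if hg : MemLp g 2 (M.meas x) then M.cyclic x hg.toLp else 0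

theorem vec_eq {x : H} {g : α → ℂ} (hg : MemLp g 2 (M.meas x)) :
    M.vec x g = M.cyclic x hg.toLp := dif_pos hg

theorem vec_toFn (x : H) (f : A) : M.vec x (M.toFn f) = M.rep f x := by
  rw [M.vec_eq (M.memLp_toFn f _)]
  exact M.cyclic_toL2 x f

theorem vec_one (x : H) : M.vec x 1 = x := by
  have := M.vec_toFn x 1
  simpa using this

theorem vec_congr {x : H} {g h : α → ℂ} (e : g =ᵐ[M.meas x] h) : M.vec x g = M.vec x h := by
  by_cases hg : MemLp g 2 (M.meas x)
  · have hh := hg.ae_eq e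
    rw [M.vec_eq hg, M.vec_eq hh, MemLp.toLp_congr hg hh e]
  · have hh : ¬ MemLp h 2 (M.meas x) := fun hh => hg (hh.ae_eq e.symm)
    rw [vec, vec, dif_neg hg, dif_neg hh]

theorem vec_add {x : H} {g h : α → ℂ} (hg : MemLp g 2 (M.meas x)) (hh : MemLp h 2 (M.meas x)) :
    M.vec x (g + h) = M.vec x g + M.vec x h := by
  rw [M.vec_eq hg, M.vec_eq hh, M.vec_eq (hg.add hh), MemLp.toLp_add, map_add]

theorem vec_sub {x : H} {g h : α → ℂ} (hg : MemLp g 2 (M.meas x)) (hh : MemLp h 2 (M.meas x)) :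
    M.vec x (g - h) = M.vec x g - M.vec x h := by
  rw [M.vec_eq hg, M.vec_eq hh, M.vec_eq (hg.sub hh), MemLp.toLp_sub, map_sub]

theorem vec_smul {x : H} {g : α → ℂ} (c : ℂ) (hg : MemLp g 2 (M.meas x)) :
    M.vec x (c • g) = c • M.vec x g := by
  rw [M.vec_eq hg, M.vec_eq (hg.const_smul c), MemLp.toLp_const_smul, map_smul]

theorem enorm_vec {x : H} {g : α → ℂ} (hg : MemLp g 2 (M.meas x)) :
    ‖M.vec x g‖ₑ = eLpNorm g 2 (M.meas x) := by
  rw [M.vec_eq hg, LinearIsometry.enorm_map, Lp.enorm_toLp]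

theorem inner_vec {x : H} {g h : α → ℂ} (hg : MemLp g 2 (M.meas x)) (hh : MemLp h 2 (M.meas x)) :
    inner ℂ (M.vec x g) (M.vec x h) = ∫ a, star (g a) * h a ∂(M.meas x) := by
  rw [M.vec_eq hg, M.vec_eq hh, LinearIsometry.inner_map_map, L2.inner_def]
  refine integral_congr_ae ?_
  filter_upwards [hg.coeFn_toLp, hh.coeFn_toLp] with a h1 h2
  rw [h1, h2]
  simp [mul_comm]

theorem inner_vec_right {x : H} {g : α → ℂ} (hg : MemLp g 2 (M.meas x)) :
    inner ℂ x (M.vec x g) = ∫ a, g a ∂(M.meas x) := by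
  have h1 : MemLp (1 : α → ℂ) 2 (M.meas x) := by
    have := M.memLp_toFn 1 (M.meas x)
    simpa using this
  have := M.inner_vec h1 hg
  simpa [M.vec_one] using this

theorem enorm_vec_sq {x : H} {g : α → ℂ} (hg : MemLp g 2 (M.meas x)) :
    ‖M.vec x g‖ₑ ^ 2 = ∫⁻ a, ‖g a‖ₑ ^ 2 ∂(M.meas x) := by
  rw [M.enorm_vec hg, eLpNorm_two_sq]

theorem norm_vec_sq {x : H} {g : α → ℂ} (hg : MemLp g 2 (M.meas x)) :
    ‖M.vec x g‖ ^ 2 = ∫ a, ‖g a‖ ^ 2 ∂(M.meas x) := by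
  have h := M.inner_vec hg hg
  rw [inner_self_eq_norm_sq_to_K] at h
  have h2 : ∀ a, star (g a) * g a = ((‖g a‖ ^ 2 : ℝ) : ℂ) := fun a => by
    rw [Complex.star_def, Complex.conj_mul']; push_cast; rfl
  simp_rw [h2] at h
  rw [integral_complex_ofReal, ← RCLike.ofReal_pow] at h
  exact Complex.ofReal_injective h

theorem measure_univ_meas (x : H) : M.meas x univ = ‖x‖ₑ ^ 2 := by
  have h1 : MemLp (1 : α → ℂ) 2 (M.meas x) := by
    have := M.memLp_toFn 1 (M.meas x)
    simpa using this
  have := M.enorm_vec_sq h1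
  rw [M.vec_one] at this
  simp [this]

/-- Approximation of `g x` by vectors `f x` with `f` in the algebra. The measure `ν` is at our
disposal, so that the same `f` can serve several vectors. -/
theorem enorm_vec_sub_rep_le {x : H} {g : α → ℂ} {ν : Measure α} {ε : ENNReal} {f : A}
    (hg : MemLp g 2 ν) (hν : M.meas x ≤ ν) (hf : eLpNorm (g - M.toFn f) 2 ν ≤ ε) :
    ‖M.vec x g - M.rep f x‖ₑ ≤ ε := by
  have hg' := hg.mono_measure hν
  rw [← M.vec_toFn, ← M.vec_sub hg' (M.memLp_toFn f _),
    M.enorm_vec (hg'.sub (M.memLp_toFn f _))]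
  exact (eLpNorm_mono_measure _ hν).trans hf

/-- Additivity in the vector, also for unbounded `g`: one and the same element of the algebra
approximates `g` in `L²` of the measures of `x`, `y` and `x + y`. -/
theorem vec_add_left {x y : H} {g : α → ℂ} (hx : MemLp g 2 (M.meas x))
    (hy : MemLp g 2 (M.meas y)) (hxy : MemLp g 2 (M.meas (x + y))) :
    M.vec (x + y) g = M.vec x g + M.vec y g := by
  refine eq_of_forall_enorm_sub_le (C := 3) (by simp) fun ε hε => ?_
  set ν := M.meas x + M.meas y + M.meas (x + y) with hν
  have hg : MemLp g 2 ν := (hx.two_add_measure hy).two_add_measure hxy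
  obtain ⟨f, hf⟩ := M.exists_approx ν inferInstance g hg ε hε
  have h1 := M.enorm_vec_sub_rep_le (x := x) hg
    ((Measure.le_add_right le_rfl).trans (Measure.le_add_right le_rfl)) hf
  have h2 := M.enorm_vec_sub_rep_le (x := y) hg
    ((Measure.le_add_left le_rfl).trans (Measure.le_add_right le_rfl)) hf
  have h3 := M.enorm_vec_sub_rep_le (x := x + y) hg (Measure.le_add_left le_rfl) hf
  have e : M.vec (x + y) g - (M.vec x g + M.vec y g) = (M.vec (x + y) g - M.rep f (x + y))
      - (M.vec x g - M.rep f x) - (M.vec y g - M.rep f y) := by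
    rw [map_add]; abel
  rw [e]
  calc _ ≤ _ := enorm_sub_le.trans (add_le_add_left enorm_sub_le _)
    _ ≤ ε + ε + ε := by gcongr
    _ = 3 * ε := by ring

theorem vec_smul_left {x : H} {g : α → ℂ} (c : ℂ) (hx : MemLp g 2 (M.meas x))
    (hc : MemLp g 2 (M.meas (c • x))) : M.vec (c • x) g = c • M.vec x g := by
  refine eq_of_forall_enorm_sub_le (C := 1 + ‖c‖ₑ) (by simp) fun ε hε => ?_
  have hg := hx.two_add_measure hc
  obtain ⟨f, hf⟩ := M.exists_approx _ inferInstance g hg ε hε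
  have h1 := M.enorm_vec_sub_rep_le (x := x) hg (Measure.le_add_right le_rfl) hf
  have h2 := M.enorm_vec_sub_rep_le (x := c • x) hg (Measure.le_add_left le_rfl) hf
  have e : M.vec (c • x) g - c • M.vec x g = (M.vec (c • x) g - M.rep f (c • x))
      - c • (M.vec x g - M.rep f x) := by
    rw [map_smul, smul_sub]; abel
  rw [e]
  calc _ ≤ _ := enorm_sub_le
    _ ≤ ε + ‖c‖ₑ * ε := by rw [enorm_smul]; gcongr
    _ = _ := by ring

open Classical in
/-- The bounded operator `∫ g dE` for a bounded measurable function `g` (and `0` for other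
functions). -/
def op (g : α → ℂ) : H →L[ℂ] H :=
  if hg : IsBddMeas g then
    LinearMap.mkContinuousOfExistsBound
      { toFun := fun x => M.vec x g
        map_add' := fun x y => M.vec_add_left (hg.memLp 2 _) (hg.memLp 2 _) (hg.memLp 2 _)
        map_smul' := fun c x => M.vec_smul_left c (hg.memLp 2 _) (hg.memLp 2 _) }
      (by
        obtain ⟨C, hC⟩ := hg.2
        refine ⟨|C|, fun x => ?_⟩
        refine le_of_sq_le_sq ?_ (by positivity)
        have hx : (M.meas x).real univ = ‖x‖ ^ 2 := by
          rw [Measure.real, M.measure_univ_meas]; simp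
        change ‖M.vec x g‖ ^ 2 ≤ _
        rw [M.norm_vec_sq (hg.memLp 2 _)]
        calc ∫ a, ‖g a‖ ^ 2 ∂(M.meas x) ≤ ∫ a, |C| ^ 2 ∂(M.meas x) := by
              refine integral_mono ((hg.memLp 2 _).integrable_norm_pow two_ne_zero)
                (integrable_const _) fun a => ?_
              have := (hC a).trans (le_abs_self C)
              dsimp only
              gcongr
          _ = (|C| * ‖x‖) ^ 2 := by rw [integral_const, hx, smul_eq_mul]; ring)
  else 0

theorem op_apply {g : α → ℂ} (hg : IsBddMeas g) (x : H) : M.op g x = M.vec x g := by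
  rw [op, dif_pos hg]; rfl

/-- Multiplicativity with a function of the algebra as the left factor. -/
theorem rep_vec (f : A) {x : H} {h : α → ℂ} (hh : MemLp h 2 (M.meas x)) :
    M.rep f (M.vec x h) = M.vec x (M.toFn f * h) := by
  obtain ⟨C, hC⟩ := (M.isBddMeas_toFn f).2
  refine eq_of_forall_enorm_sub_le (C := ‖M.rep f‖ₑ + ‖C‖ₑ) (by simp) fun ε hε => ?_
  obtain ⟨k, hk⟩ := M.exists_approx _ inferInstance h hh ε hε
  have h1 := M.enorm_vec_sub_rep_le (x := x) hh le_rfl hk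
  have hfh := (M.isBddMeas_toFn f).memLp_mul hh
  have h2 : ‖M.vec x (M.toFn f * h) - M.rep (f * k) x‖ₑ ≤ ‖C‖ₑ * ε := by
    refine M.enorm_vec_sub_rep_le hfh le_rfl ?_
    have e : M.toFn f * h - M.toFn (f * k) = M.toFn f * (h - M.toFn k) := by
      rw [map_mul, mul_sub]
    rw [e]
    refine le_trans ?_ (mul_le_mul_right hk _)
    have := eLpNorm_const_smul C (h - M.toFn k) 2 (M.meas x)
    rw [← this]
    refine eLpNorm_mono fun a => ?_
    rw [Pi.mul_apply, Pi.smul_apply, norm_mul, norm_smul]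
    gcongr
    exact (hC a).trans (le_abs_self C)
  have e : M.rep f (M.vec x h) - M.vec x (M.toFn f * h) =
      M.rep f (M.vec x h - M.rep k x) - (M.vec x (M.toFn f * h) - M.rep (f * k) x) := by
    rw [map_sub, map_mul, mul_apply_eq_comp]; abel
  rw [e, add_mul]
  refine enorm_sub_le.trans (add_le_add ?_ h2)
  exact ((M.rep f).le_opENorm _).trans (mul_le_mul_right h1 _)

/-- Multiplicativity. The function `g` is approximated both in `L²` of the measure of `h x` and in
`L²(|h|² μ_x)`; that these measures agree (`meas_vec`) is a consequence. -/
theorem vec_vec {g : α → ℂ} (hg : IsBddMeas g) {x : H} {h : α → ℂ}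
    (hh : MemLp h 2 (M.meas x)) : M.vec (M.vec x h) g = M.vec x (g * h) := by
  refine eq_of_forall_enorm_sub_le (C := 2) (by simp) fun ε hε => ?_
  set ρ := (M.meas x).withDensity fun a => ‖h a‖ₑ ^ 2 with hρ
  have hρf : IsFiniteMeasure ρ := by
    refine isFiniteMeasure_withDensity ?_
    rw [← M.enorm_vec_sq hh]
    simp
  set ν := M.meas (M.vec x h) + ρ with hν
  obtain ⟨f, hf⟩ := M.exists_approx ν inferInstance g (hg.memLp 2 ν) ε hε
  have h1 := M.enorm_vec_sub_rep_le (x := M.vec x h) (hg.memLp 2 ν)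
    (Measure.le_add_right le_rfl) hf
  have hgh := hg.memLp_mul hh
  have hfh := (M.isBddMeas_toFn f).memLp_mul hh
  have h2 : ‖M.vec x (g * h) - M.vec x (M.toFn f * h)‖ₑ ≤ ε := by
    rw [← M.vec_sub hgh hfh]
    refine le_trans ?_ ((eLpNorm_mono_measure _ (Measure.le_add_left le_rfl : ρ ≤ ν)).trans hf)
    refine le_of_eq ?_
    refine (ENNReal.pow_right_strictMono two_ne_zero).injective ?_
    rw [M.enorm_vec_sq (hgh.sub hfh)]
    rw [eLpNorm_two_sq, hρ, lintegral_withDensity_eq_lintegral_mul₀ (hh.1.enorm.pow_const 2)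
      ((hg.1.sub (M.isBddMeas_toFn f).1).enorm.pow_const 2).aemeasurable]
    refine lintegral_congr fun a => ?_
    simp only [Pi.mul_apply, Pi.sub_apply]
    rw [← sub_mul, enorm_mul, mul_pow, mul_comm]
  rw [M.rep_vec f hh] at h1
  have e : M.vec (M.vec x h) g - M.vec x (g * h) =
      (M.vec (M.vec x h) g - M.vec x (M.toFn f * h))
      - (M.vec x (g * h) - M.vec x (M.toFn f * h)) := by abel
  rw [e]
  calc _ ≤ _ := enorm_sub_le
    _ ≤ ε + ε := by gcongr
    _ = 2 * ε := by ring

theorem op_vec {g : α → ℂ} (hg : IsBddMeas g) {x : H} {h : α → ℂ}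
    (hh : MemLp h 2 (M.meas x)) : M.op g (M.vec x h) = M.vec x (g * h) := by
  rw [M.op_apply hg, M.vec_vec hg hh]

theorem op_mul {g h : α → ℂ} (hg : IsBddMeas g) (hh : IsBddMeas h) :
    M.op (g * h) = M.op g * M.op h := by
  ext x
  rw [mul_apply_eq_comp, M.op_apply hh, M.op_vec hg (hh.memLp 2 _),
    M.op_apply (hg.mul hh)]

theorem op_one : M.op 1 = 1 := by
  ext x
  have h1 : IsBddMeas (1 : α → ℂ) := by
    have := M.isBddMeas_toFn 1
    simpa using this
  rw [M.op_apply h1, M.vec_one]; rfl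

/-- An operator `∫ g dE` with real `g` is self-adjoint, having a real quadratic form. -/
theorem isSelfAdjoint_op {g : α → ℂ} (hg : IsBddMeas g) (hr : ∀ a, star (g a) = g a) :
    IsSelfAdjoint (M.op g) := by
  rw [ContinuousLinearMap.isSelfAdjoint_iff_isSymmetric,
    LinearMap.isSymmetric_iff_inner_map_self_real]
  intro x
  have h := M.inner_vec_right (hg.memLp 2 (M.meas x))
  rw [ContinuousLinearMap.coe_coe, M.op_apply hg, inner_conj_symm, ← inner_conj_symm (M.vec x g) x,
    h, ← integral_conj]
  exact integral_congr_ae (Filter.Eventually.of_forall fun a => (hr a).symm)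

theorem meas_vec {x : H} {h : α → ℂ} (hh : MemLp h 2 (M.meas x)) :
    M.meas (M.vec x h) = (M.meas x).withDensity fun a => ‖h a‖ₑ ^ 2 := by
  ext S hS
  have h1 := IsBddMeas.indicator_one (α := α) hS
  have e1 := M.enorm_vec_sq (h1.memLp 2 (M.meas (M.vec x h)))
  have e2 := M.enorm_vec_sq (h1.memLp_mul hh)
  rw [M.vec_vec h1 hh, e2] at e1
  rw [withDensity_apply _ hS, ← lintegral_indicator hS]
  have e3 : ∫⁻ a, ‖S.indicator (1 : α → ℂ) a‖ₑ ^ 2 ∂(M.meas (M.vec x h))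
      = M.meas (M.vec x h) S := by
    rw [← lintegral_indicator_one hS]
    refine lintegral_congr fun a => ?_
    by_cases ha : a ∈ S <;> simp [ha]
  rw [← e3, ← e1]
  refine lintegral_congr fun a => ?_
  by_cases ha : a ∈ S <;> simp [ha]

theorem enorm_op_indicator_sq {S : Set α} (hS : MeasurableSet S) (x : H) :
    ‖M.op (S.indicator 1) x‖ₑ ^ 2 = M.meas x S := by
  have h1 := IsBddMeas.indicator_one (α := α) hS
  rw [M.op_apply h1, M.enorm_vec_sq (h1.memLp 2 _), ← lintegral_indicator_one hS]
  refine lintegral_congr fun a => ?_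
  by_cases ha : a ∈ S <;> simp [ha]

end MeasurableRep

/-! ### Integration of simple functions against a projection-valued measure -/

/-- A bounded operator on a complex space is determined by its quadratic form. -/
theorem ContinuousLinearMap.eq_of_inner_self {H : Type*} [NormedAddCommGroup H]
    [InnerProductSpace ℂ H] {A B : H →L[ℂ] H} (h : ∀ x, inner ℂ x (A x) = inner ℂ x (B x)) :
    A = B := by
  have h' : (A : H →ₗ[ℂ] H) = (B : H →ₗ[ℂ] H) := by
    refine (ext_inner_map _ _).1 fun x => ?_
    rw [← inner_conj_symm, ← inner_conj_symm ((B : H →ₗ[ℂ] H) x)]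
    exact congrArg _ (h x)
  ext x
  exact congrArg (fun L : H →ₗ[ℂ] H => L x) h'

namespace ProjValuedMeasure

variable {H : Type*} [NormedAddCommGroup H] [InnerProductSpace ℂ H] [CompleteSpace H]
  (P : ProjValuedMeasure H)

instance (x : H) : IsFiniteMeasure (P.scalar x) :=
  ⟨by rw [P.scalar_apply x MeasurableSet.univ]; exact ENNReal.ofReal_lt_top⟩

theorem inner_proj_eq_measureReal {S : Set ℝ} (hS : MeasurableSet S) (x : H) :
    inner ℂ x (P.proj S x) = ((P.scalar x).real S : ℂ) := by
  rw [P.inner_proj hS, Measure.real, P.scalar_apply x hS, ENNReal.toReal_ofReal (by positivity)]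

theorem scalar_proj {S : Set ℝ} (hS : MeasurableSet S) (x : H) :
    P.scalar (P.proj S x) = (P.scalar x).restrict S := by
  ext U hU
  rw [Measure.restrict_apply hU, P.scalar_apply _ hU, P.scalar_apply _ (hU.inter hS),
    P.proj_inter U S hU hS]
  rfl

/-- The integral `∫ s dP` of a simple function. -/
def simpleOp (s : SimpleFunc ℝ ℂ) : H →L[ℂ] H :=
  ∑ v ∈ s.range, v • P.proj (s ⁻¹' {v})

theorem integrable_simpleFunc (s : SimpleFunc ℝ ℂ) (ν : Measure ℝ) [IsFiniteMeasure ν] :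
    Integrable s ν := SimpleFunc.integrable_of_isFiniteMeasure s

theorem inner_simpleOp (s : SimpleFunc ℝ ℂ) (x : H) :
    inner ℂ x (P.simpleOp s x) = ∫ t, s t ∂(P.scalar x) := by
  rw [SimpleFunc.integral_eq_sum s (integrable_simpleFunc s _), simpleOp,
    sum_apply, inner_sum]
  refine Finset.sum_congr rfl fun v _ => ?_
  rw [smul_apply, inner_smul_right,
    P.inner_proj_eq_measureReal (s.measurableSet_fiber v), Complex.real_smul, mul_comm]

theorem simpleOp_add (s t : SimpleFunc ℝ ℂ) : P.simpleOp (s + t) = P.simpleOp s + P.simpleOp t := by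
  refine ContinuousLinearMap.eq_of_inner_self fun x => ?_
  rw [add_apply, inner_add_right]
  simp only [inner_simpleOp]
  exact integral_add (integrable_simpleFunc s _) (integrable_simpleFunc t _)

theorem simpleOp_smul (c : ℂ) (s : SimpleFunc ℝ ℂ) : P.simpleOp (c • s) = c • P.simpleOp s := by
  refine ContinuousLinearMap.eq_of_inner_self fun x => ?_
  rw [smul_apply, inner_smul_right]
  simp only [inner_simpleOp]
  exact integral_const_mul c _

theorem simpleOp_one : P.simpleOp 1 = 1 := by
  refine ContinuousLinearMap.eq_of_inner_self fun x => ?_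
  have h := P.inner_proj_eq_measureReal MeasurableSet.univ x
  rw [P.proj_univ] at h
  rw [inner_simpleOp, h]
  simp

theorem simpleOp_star (s : SimpleFunc ℝ ℂ) : P.simpleOp (star s) = star (P.simpleOp s) := by
  refine ContinuousLinearMap.eq_of_inner_self fun x => ?_
  rw [inner_simpleOp, ContinuousLinearMap.star_eq_adjoint, ContinuousLinearMap.adjoint_inner_right,
    ← inner_conj_symm, inner_simpleOp]
  exact integral_conj

theorem commute_proj_simpleOp {S : Set ℝ} (hS : MeasurableSet S) (s : SimpleFunc ℝ ℂ) :
    Commute (P.proj S) (P.simpleOp s) := by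
  refine Commute.sum_right _ _ _ fun v _ => Commute.smul_right ?_ v
  rw [Commute, SemiconjBy, ← P.proj_inter _ _ hS (s.measurableSet_fiber v),
    ← P.proj_inter _ _ (s.measurableSet_fiber v) hS, inter_comm]

theorem simpleOp_indicator_mul {S : Set ℝ} (hS : MeasurableSet S) (s : SimpleFunc ℝ ℂ) :
    P.simpleOp (SimpleFunc.piecewise S hS 1 0 * s) = P.proj S * P.simpleOp s := by
  refine ContinuousLinearMap.eq_of_inner_self fun x => ?_
  have hp := P.isStarProjection_proj S hS
  have h1 : P.proj S * P.simpleOp s = P.proj S * P.simpleOp s * P.proj S := by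
    rw [mul_assoc, ← (P.commute_proj_simpleOp hS s).eq, ← mul_assoc, hp.isIdempotentElem.eq]
  rw [h1, mul_apply_eq_comp, mul_apply_eq_comp]
  have h2 : ∀ y : H, inner ℂ x (P.proj S y) = inner ℂ (P.proj S x) y := by
    intro y
    rw [← ContinuousLinearMap.adjoint_inner_left, ← ContinuousLinearMap.star_eq_adjoint,
      hp.isSelfAdjoint.star_eq]
  rw [h2, inner_simpleOp, inner_simpleOp, P.scalar_proj hS, ← integral_indicator hS]
  refine integral_congr_ae (Filter.Eventually.of_forall fun t => ?_)
  by_cases ht : t ∈ S <;> simp [ht]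

/-- Multiplicativity follows from that of indicator functions by linearity, with no need to refine
partitions. -/
theorem simpleOp_mul (s t : SimpleFunc ℝ ℂ) : P.simpleOp (s * t) = P.simpleOp s * P.simpleOp t := by
  induction s using SimpleFunc.induction with
  | const c hS =>
    rename_i S
    have e : SimpleFunc.piecewise S hS (SimpleFunc.const ℝ c) (SimpleFunc.const ℝ 0)
        = c • (SimpleFunc.piecewise S hS 1 0 : SimpleFunc ℝ ℂ) := by
      ext a
      by_cases ha : a ∈ S <;> simp [ha]
    have h1 := P.simpleOp_indicator_mul hS 1
    rw [mul_one, P.simpleOp_one, mul_one] at h1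
    rw [e, smul_mul_assoc, P.simpleOp_smul, P.simpleOp_smul, P.simpleOp_indicator_mul hS, h1,
      smul_mul_assoc]
  | add _ hf hg => rw [add_mul, P.simpleOp_add, hf, hg, P.simpleOp_add, add_mul]

theorem isBddMeas_simpleFunc (s : SimpleFunc ℝ ℂ) : IsBddMeas s := by
  refine ⟨s.measurable, ?_⟩
  obtain ⟨C, hC⟩ := s.exists_forall_norm_le
  exact ⟨C, hC⟩

/-- The functional calculus of a projection-valued measure, from the simple functions. -/
def measurableRep : MeasurableRep ℝ H (SimpleFunc ℝ ℂ) where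
  toFn :=
    { toFun := fun s => s
      map_one' := rfl
      map_mul' := fun _ _ => rfl
      map_zero' := rfl
      map_add' := fun _ _ => rfl
      commutes' := fun _ => rfl
      map_star' := fun _ => rfl }
  rep :=
    { toFun := P.simpleOp
      map_one' := P.simpleOp_one
      map_mul' := P.simpleOp_mul
      map_zero' := by simpa using P.simpleOp_smul 0 0
      map_add' := P.simpleOp_add
      commutes' := fun c => by
        rw [Algebra.algebraMap_eq_smul_one, P.simpleOp_smul, P.simpleOp_one,
          Algebra.algebraMap_eq_smul_one]
      map_star' := P.simpleOp_star }
  meas := P.scalar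
  isFiniteMeasure_meas _ := inferInstance
  isBddMeas_toFn s := isBddMeas_simpleFunc s
  inner_rep x s := P.inner_simpleOp s x
  exists_approx ν _ g hg ε hε := by
    obtain ⟨s, hs, -⟩ := hg.exists_simpleFunc_eLpNorm_sub_lt (by simp) hε
    exact ⟨s, hs.le⟩

end ProjValuedMeasure

/-! ### Resolvents of self-adjoint operators -/

section

variable {H : Type*} [NormedAddCommGroup H] [InnerProductSpace ℂ H]

theorem resolventOp_eq {T : H →ₗ.[ℂ] H} {z : ℂ} {R : H →L[ℂ] H} (h : IsResolventAt T z R) :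
    resolventOp T z = R := by
  have h' : ∃ R : H →L[ℂ] H, IsResolventAt T z R := ⟨R, h⟩
  rw [resolventOp, dif_pos h']
  exact h'.choose_spec.unique h

variable [CompleteSpace H]

theorem isOpen_compl_unboundedSpectrum (T : H →ₗ.[ℂ] H) : IsOpen (unboundedSpectrum T)ᶜ := by
  rw [Metric.isOpen_iff]
  intro z hz
  obtain ⟨R, hR⟩ : ∃ R : H →L[ℂ] H, IsResolventAt T z R := not_not.1 hz
  refine ⟨(‖R‖ + 1)⁻¹, by positivity, fun w hw => not_not.2 ?_⟩
  -- Neumann series: `T - w = (1 - (w - z) R) (T - z)`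
  have hlt : ‖(w - z) • R‖ < 1 := by
    rw [Metric.mem_ball, dist_eq_norm] at hw
    rw [norm_smul]
    have h0 : 0 < ‖R‖ + 1 := by positivity
    calc ‖w - z‖ * ‖R‖ ≤ ‖w - z‖ * (‖R‖ + 1) := by gcongr; linarith
      _ < (‖R‖ + 1)⁻¹ * (‖R‖ + 1) := by gcongr
      _ = 1 := inv_mul_cancel₀ h0.ne'
  set u := Units.oneSub ((w - z) • R) hlt with hu
  have huval : (u : H →L[ℂ] H) = 1 - (w - z) • R := rfl
  have key : ∀ x : T.domain, T x - w • (x : H) = (u : H →L[ℂ] H) (T x - z • (x : H)) := by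
    intro x
    rw [huval, sub_apply, smul_apply, hR.1 x,
      one_apply_eq_self, sub_smul]
    abel
  refine ⟨R * ((u⁻¹ : (H →L[ℂ] H)ˣ) : H →L[ℂ] H), fun x => ?_, fun y => ?_⟩
  · rw [key, mul_apply_eq_comp, ← mul_apply_eq_comp _ (u : H →L[ℂ] H), Units.inv_mul,
      one_apply_eq_self, hR.1 x]
  · obtain ⟨h, e⟩ := hR.2 (((u⁻¹ : (H →L[ℂ] H)ˣ) : H →L[ℂ] H) y)
    refine ⟨h, ?_⟩
    have := key ⟨_, h⟩
    refine this.trans ?_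
    change (u : H →L[ℂ] H) (T ⟨_, h⟩ - z • R (((u⁻¹ : (H →L[ℂ] H)ˣ) : H →L[ℂ] H) y)) = y
    rw [e, ← mul_apply_eq_comp, Units.mul_inv, one_apply_eq_self]

theorem isClosed_realSpectrum (T : H →ₗ.[ℂ] H) : IsClosed (realSpectrum T) := by
  have h : IsClosed (unboundedSpectrum T) := isOpen_compl_iff.1 (isOpen_compl_unboundedSpectrum T)
  exact h.preimage Complex.continuous_ofReal

end

/-- The operator `T - z`, defined on the domain of `T`. -/
def LinearPMap.subSMul {H : Type*} [NormedAddCommGroup H] [InnerProductSpace ℂ H]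
    (T : H →ₗ.[ℂ] H) (z : ℂ) : T.domain →ₗ[ℂ] H :=
  T.toFun - z • T.domain.subtype

theorem LinearPMap.subSMul_apply {H : Type*} [NormedAddCommGroup H] [InnerProductSpace ℂ H]
    (T : H →ₗ.[ℂ] H) (z : ℂ) (x : T.domain) : T.subSMul z x = T x - z • (x : H) := rfl

namespace IsSelfAdjoint

variable {H : Type*} [NormedAddCommGroup H] [InnerProductSpace ℂ H] [CompleteSpace H]
  {T : H →ₗ.[ℂ] H}

theorem linearPMap_inner (hT : IsSelfAdjoint T) (x y : T.domain) :
    inner ℂ (T x) (y : H) = inner ℂ (x : H) (T y) := by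
  have h := LinearPMap.adjoint_isFormalAdjoint hT.dense_domain
  rw [LinearPMap.isSelfAdjoint_def.1 hT] at h
  exact h x y

/-- The domain of a self-adjoint operator is maximal: it contains `y` as soon as
`x ↦ ⟪y, T x⟫` is represented by a vector `w`. -/
theorem linearPMap_mem_domain (hT : IsSelfAdjoint T) {y w : H}
    (h : ∀ x : T.domain, inner ℂ w (x : H) = inner ℂ y (T x)) :
    ∃ hy : y ∈ T.domain, T ⟨y, hy⟩ = w := by
  have hy : y ∈ T.adjoint.domain := LinearPMap.mem_adjoint_domain_of_exists y ⟨w, h⟩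
  have e : T.adjoint ⟨y, hy⟩ = w := LinearPMap.adjoint_apply_eq hT.dense_domain _ h
  have hT' := LinearPMap.isSelfAdjoint_def.1 hT
  have : ∀ S : H →ₗ.[ℂ] H, S = T → ∀ hy : y ∈ S.domain, S ⟨y, hy⟩ = w →
      ∃ hy : y ∈ T.domain, T ⟨y, hy⟩ = w := by
    rintro S rfl hy e
    exact ⟨hy, e⟩
  exact this _ hT' hy e

theorem linearPMap_inner_self_im (hT : IsSelfAdjoint T) (x : T.domain) :
    (inner ℂ (x : H) (T x)).im = 0 := by
  have h := hT.linearPMap_inner x x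
  rw [← inner_conj_symm] at h
  exact Complex.conj_eq_iff_im.1 h

/-- The lower bound for `T - z`, from the imaginary part of `⟪x, (T - z) x⟫`. -/
theorem norm_le_norm_sub_smul (hT : IsSelfAdjoint T) (z : ℂ) (x : T.domain) :
    |z.im| * ‖(x : H)‖ ≤ ‖T x - z • (x : H)‖ := by
  by_cases hx : ‖(x : H)‖ = 0
  · rw [hx, mul_zero]; positivity
  have h1 : (inner ℂ (x : H) (T x - z • (x : H))).im = -(z.im * ‖(x : H)‖ ^ 2) := by
    rw [inner_sub_right, inner_smul_right, inner_self_eq_norm_sq_to_K, Complex.sub_im,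
      hT.linearPMap_inner_self_im]
    rw [← RCLike.ofReal_pow]
    change 0 - (z * ((‖(x : H)‖ ^ 2 : ℝ) : ℂ)).im = _
    rw [Complex.im_mul_ofReal]
    ring
  have h2 : |z.im| * ‖(x : H)‖ ^ 2 ≤ ‖(x : H)‖ * ‖T x - z • (x : H)‖ := by
    refine le_trans (le_of_eq ?_) ((Complex.abs_im_le_norm _).trans (norm_inner_le_norm _ _))
    rw [h1, abs_neg, abs_mul, abs_of_nonneg (sq_nonneg ‖(x : H)‖)]
  have h3 : 0 < ‖(x : H)‖ := lt_of_le_of_ne (norm_nonneg _) (Ne.symm hx)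
  nlinarith

theorem isClosed_range_sub (hT : IsSelfAdjoint T) {z : ℂ} (hz : z.im ≠ 0) :
    IsClosed (LinearMap.range (T.subSMul z) : Set H) := by
  have hz' : 0 < |z.im| := abs_pos.2 hz
  refine isClosed_of_closure_subset fun y hy => ?_
  obtain ⟨u, hu, hlim⟩ := mem_closure_iff_seq_limit.1 hy
  choose x hx using hu
  have hb : ∀ m n, dist (x m : H) (x n) ≤ |z.im|⁻¹ * dist (u m) (u n) := by
    intro m n
    have := hT.norm_le_norm_sub_smul z (x m - x n)
    rw [← LinearPMap.subSMul_apply, map_sub, hx, hx] at this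
    rw [dist_eq_norm, dist_eq_norm, ← div_eq_inv_mul, le_div_iff₀ hz', mul_comm]
    exact this
  have hc : CauchySeq fun n => (x n : H) := by
    have hu' := hlim.cauchySeq
    rw [Metric.cauchySeq_iff'] at hu' ⊢
    intro ε hε
    obtain ⟨N, hN⟩ := hu' (|z.im| * ε) (by positivity)
    refine ⟨N, fun n hn => (hb n N).trans_lt ?_⟩
    calc |z.im|⁻¹ * dist (u n) (u N) < |z.im|⁻¹ * (|z.im| * ε) := by
          have := hN n hn
          gcongr
      _ = ε := by field_simp
  obtain ⟨x', hx'⟩ := cauchySeq_tendsto_of_complete hc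
  -- the limit lies in the domain by symmetry, with `T x' = y + z x'`
  obtain ⟨h, e⟩ := hT.linearPMap_mem_domain (y := x') (w := y + z • x') fun v => by
    have h1 : Filter.Tendsto (fun n => inner ℂ (u n + z • (x n : H)) (v : H)) Filter.atTop
        (nhds (inner ℂ (y + z • x') (v : H))) :=
      (hlim.add (hx'.const_smul z)).inner tendsto_const_nhds
    have h2 : Filter.Tendsto (fun n => inner ℂ (x n : H) (T v)) Filter.atTop
        (nhds (inner ℂ x' (T v))) := hx'.inner tendsto_const_nhds
    refine tendsto_nhds_unique h1 (h2.congr fun n => ?_)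
    rw [← hx n, LinearPMap.subSMul_apply, sub_add_cancel, hT.linearPMap_inner]
  exact ⟨⟨x', h⟩, by rw [LinearPMap.subSMul_apply, e]; simp⟩

/-- The range is closed, and a vector orthogonal to it would be an eigenvector of `T` for the
eigenvalue `conj z`. -/
theorem range_sub_eq_top (hT : IsSelfAdjoint T) {z : ℂ} (hz : z.im ≠ 0) :
    LinearMap.range (T.subSMul z) = ⊤ := by
  have : (LinearMap.range (T.subSMul z)).HasOrthogonalProjection :=
    haveI := (hT.isClosed_range_sub hz).completeSpace_coe
    inferInstance
  rw [← Submodule.orthogonal_eq_bot_iff, Submodule.eq_bot_iff]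
  intro y hy
  rw [Submodule.mem_orthogonal'] at hy
  obtain ⟨h, e⟩ := hT.linearPMap_mem_domain (y := y) (w := (starRingEnd ℂ z) • y) fun x => by
    have := hy _ ⟨x, rfl⟩
    rw [LinearPMap.subSMul_apply, inner_sub_right, inner_smul_right, sub_eq_zero] at this
    rw [this, inner_smul_left, Complex.conj_conj]
  have h1 := hT.norm_le_norm_sub_smul (starRingEnd ℂ z) ⟨y, h⟩
  rw [e, sub_self, norm_zero, Complex.conj_im, abs_neg] at h1
  have h2 : 0 < |z.im| := abs_pos.2 hz
  have h3 : ‖y‖ ≤ 0 := by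
    by_contra h4
    push Not at h4
    have : 0 < |z.im| * ‖y‖ := by positivity
    exact absurd h1 (not_le.2 this)
  exact norm_le_zero_iff.1 h3

theorem exists_isResolventAt (hT : IsSelfAdjoint T) {z : ℂ} (hz : z.im ≠ 0) :
    ∃ R : H →L[ℂ] H, IsResolventAt T z R := by
  have hz' : 0 < |z.im| := abs_pos.2 hz
  have hinj : Function.Injective (T.subSMul z) := by
    rw [injective_iff_map_eq_zero]
    intro x hx
    have := hT.norm_le_norm_sub_smul z x
    rw [← LinearPMap.subSMul_apply, hx, norm_zero] at this
    have h3 : ‖(x : H)‖ ≤ 0 := by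
      by_contra h4
      push Not at h4
      have : 0 < |z.im| * ‖(x : H)‖ := by positivity
      linarith
    exact Subtype.ext (norm_le_zero_iff.1 h3)
  let e := LinearEquiv.ofBijective (T.subSMul z)
    ⟨hinj, LinearMap.range_eq_top.1 (hT.range_sub_eq_top hz)⟩
  have he : ∀ x : T.domain, e x = T x - z • (x : H) := fun x => rfl
  let R : H →L[ℂ] H := LinearMap.mkContinuous (T.domain.subtype ∘ₗ e.symm.toLinearMap) |z.im|⁻¹
    fun y => by
      have h := hT.norm_le_norm_sub_smul z (e.symm y)
      rw [← he, e.apply_symm_apply] at h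
      rw [← div_eq_inv_mul, le_div_iff₀ hz', mul_comm]
      exact h
  have hR : ∀ y, R y = (e.symm y : H) := fun y => rfl
  refine ⟨R, fun x => ?_, fun y => ?_⟩
  · rw [hR, ← he, e.symm_apply_apply]
  · refine ⟨by rw [hR]; exact (e.symm y).2, ?_⟩
    have := he (e.symm y)
    rw [e.apply_symm_apply] at this
    exact this.symm

end IsSelfAdjoint

namespace IsResolventAt

variable {H : Type*} [NormedAddCommGroup H] [InnerProductSpace ℂ H]
  {T : H →ₗ.[ℂ] H} {z w : ℂ} {R S : H →L[ℂ] H}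

/-- The resolvent identity. -/
theorem sub_eq (hR : IsResolventAt T z R) (hS : IsResolventAt T w S) :
    R - S = (z - w) • (R * S) := by
  ext y
  obtain ⟨h, e⟩ := hS.2 y
  have h1 := hR.1 ⟨S y, h⟩
  have e2 : T ⟨S y, h⟩ - z • S y = y - (z - w) • S y := by
    have e' : T ⟨S y, h⟩ = y + w • S y := sub_eq_iff_eq_add.1 e
    rw [e', sub_smul]
    abel
  rw [e2, map_sub, map_smul] at h1
  rw [sub_apply, smul_apply, mul_apply_eq_comp,
    sub_eq_iff_eq_add, ← sub_eq_iff_eq_add']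
  exact h1

theorem star_eq [CompleteSpace H] (hT : IsSelfAdjoint T) (hR : IsResolventAt T z R)
    (hS : IsResolventAt T (starRingEnd ℂ z) S) : star R = S := by
  rw [ContinuousLinearMap.star_eq_adjoint]
  symm
  rw [ContinuousLinearMap.eq_adjoint_iff]
  intro x y
  obtain ⟨h, e⟩ := hS.2 x
  obtain ⟨h', e'⟩ := hR.2 y
  conv_lhs => rw [← e']
  conv_rhs => rw [← e]
  have := hT.linearPMap_inner ⟨S x, h⟩ ⟨R y, h'⟩
  rw [inner_sub_left, inner_sub_right, this, inner_smul_left, inner_smul_right, Complex.conj_conj]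

end IsResolventAt

/-! ### The functional calculus of a normal operator -/

namespace NormalOperator

variable {H : Type*} [NormedAddCommGroup H] [InnerProductSpace ℂ H] [CompleteSpace H]
  {a : H →L[ℂ] H} (ha : IsStarNormal a)

/-- A real function as a complex one. -/
def complexify {X : Type*} [TopologicalSpace X] (f : C(X, ℝ)) : C(X, ℂ) :=
  ⟨fun z => (f z : ℂ), by fun_prop⟩

theorem isSelfAdjoint_cfcHom_complexify (f : C(spectrum ℂ a, ℝ)) :
    IsSelfAdjoint (cfcHom ha (complexify f)) := by
  rw [IsSelfAdjoint, ← map_star]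
  congr 1
  ext z
  simp [complexify]

theorem inner_cfcHom_complexify (f : C(spectrum ℂ a, ℝ)) (x : H) :
    inner ℂ x (cfcHom ha (complexify f) x)
      = ((inner ℂ x (cfcHom ha (complexify f) x)).re : ℂ) := by
  have h := isSelfAdjoint_cfcHom_complexify ha f
  rw [ContinuousLinearMap.isSelfAdjoint_iff_isSymmetric] at h
  have h1 := h x x
  rw [ContinuousLinearMap.coe_coe, ← inner_conj_symm] at h1
  exact (Complex.conj_eq_iff_re.1 h1).symm

/-- The positive functional `f ↦ ⟪x, f(a) x⟫`. -/
def functional (x : H) :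
    CompactlySupportedContinuousMap (spectrum ℂ a) ℝ →ₚ[ℝ] ℝ :=
  PositiveLinearMap.mk₀
    { toFun := fun f => (inner ℂ x (cfcHom ha (complexify f.toContinuousMap) x)).re
      map_add' := fun f g => by
        have e : complexify (f + g : CompactlySupportedContinuousMap (spectrum ℂ a) ℝ).1
            = complexify f.1 + complexify g.1 := by
          ext z; simp [complexify]
        change (inner ℂ x (cfcHom ha (complexify _) x)).re = _
        rw [e, map_add, add_apply, inner_add_right, Complex.add_re]
      map_smul' := fun c f => by
        have e : complexify (c • f : CompactlySupportedContinuousMap (spectrum ℂ a) ℝ).1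
            = (c : ℂ) • complexify f.1 := by
          ext z; simp [complexify]
        change (inner ℂ x (cfcHom ha (complexify _) x)).re = _
        rw [e, map_smul, smul_apply, inner_smul_right, Complex.re_ofReal_mul]
        rfl }
    (by
      intro f hf
      let g : C(spectrum ℂ a, ℝ) := ⟨fun z => Real.sqrt (f z), by fun_prop⟩
      have e : complexify f.1 = complexify g * complexify g := by
        ext z
        have : (0 : ℝ) ≤ f z := hf z
        simp only [complexify, ContinuousMap.coe_mk, ContinuousMap.mul_apply, g]
        rw [← Complex.ofReal_mul, Real.mul_self_sqrt this]
        rfl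
      have hg := isSelfAdjoint_cfcHom_complexify ha g
      change 0 ≤ (inner ℂ x (cfcHom ha (complexify f.1) x)).re
      rw [e, map_mul, mul_apply_eq_comp]
      nth_rewrite 1 [← hg.star_eq]
      rw [ContinuousLinearMap.star_eq_adjoint, ContinuousLinearMap.adjoint_inner_right]
      exact inner_self_nonneg (𝕜 := ℂ))

/-- The measure of `x` represents the functional on complex functions as well, by splitting them
into real and imaginary parts. -/
theorem inner_cfcHom_eq_integral (x : H) (f : C(spectrum ℂ a, ℂ)) :
    inner ℂ x (cfcHom ha f x) = ∫ z, f z ∂(RealRMK.rieszMeasure (functional ha x)) := by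
  set ν := RealRMK.rieszMeasure (functional ha x)
  have hreal : ∀ g : C(spectrum ℂ a, ℝ),
      inner ℂ x (cfcHom ha (complexify g) x) = ((∫ z, g z ∂ν : ℝ) : ℂ) := by
    intro g
    let g' : CompactlySupportedContinuousMap (spectrum ℂ a) ℝ :=
      ⟨g, HasCompactSupport.of_compactSpace _⟩
    have := RealRMK.integral_rieszMeasure (functional ha x) g'
    rw [inner_cfcHom_complexify]
    exact congrArg _ this.symm
  let u : C(spectrum ℂ a, ℝ) := ⟨fun z => (f z).re, by fun_prop⟩
  let v : C(spectrum ℂ a, ℝ) := ⟨fun z => (f z).im, by fun_prop⟩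
  have e : f = complexify u + Complex.I • complexify v := by
    ext z
    simp only [complexify, ContinuousMap.add_apply, ContinuousMap.smul_apply, ContinuousMap.coe_mk,
      smul_eq_mul, u, v]
    rw [mul_comm, Complex.re_add_im]
  have hi : Integrable f ν := by
    have := f.continuous.integrable_of_hasCompactSupport (μ := ν)
      (HasCompactSupport.of_compactSpace _)
    exact this
  conv_lhs => rw [e]
  rw [map_add, map_smul, add_apply, smul_apply, inner_add_right, inner_smul_right, hreal, hreal,
    mul_comm]
  exact integral_re_add_im hi

/-- The functional calculus of a normal operator, from the continuous functions on its spectrum. -/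
def measurableRep : MeasurableRep (spectrum ℂ a) H C(spectrum ℂ a, ℂ) where
  toFn :=
    { toFun := fun f => f
      map_one' := rfl
      map_mul' := fun _ _ => rfl
      map_zero' := rfl
      map_add' := fun _ _ => rfl
      commutes' := fun _ => rfl
      map_star' := fun _ => rfl }
  rep := cfcHom ha
  meas x := RealRMK.rieszMeasure (functional ha x)
  isFiniteMeasure_meas x := inferInstance
  isBddMeas_toFn f := ⟨f.continuous.measurable, ‖f‖, fun z => f.norm_coe_le_norm z⟩
  inner_rep x f := inner_cfcHom_eq_integral ha x f
  exists_approx ν _ g hg ε hε := by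
    obtain ⟨f, hf, -⟩ := hg.exists_boundedContinuous_eLpNorm_sub_le (by simp) hε
    exact ⟨f.toContinuousMap, hf⟩

theorem measurableRep_op_id : (measurableRep ha).op (fun z => (z : ℂ)) = a := by
  have h := cfcHom_id (R := ℂ) ha
  ext x
  have hb := (measurableRep ha).isBddMeas_toFn ((ContinuousMap.id ℂ).restrict (spectrum ℂ a))
  refine ((measurableRep ha).op_apply hb x).trans ?_
  refine ((measurableRep ha).vec_toFn x ((ContinuousMap.id ℂ).restrict (spectrum ℂ a))).trans ?_
  exact congrArg (fun B : H →L[ℂ] H => B x) h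

end NormalOperator

/-! ### The spectral theorem for self-adjoint operators -/

namespace MeasurableRep

variable {α H A : Type*} [MeasurableSpace α] [NormedAddCommGroup H]
    [InnerProductSpace ℂ H] [CompleteSpace H] [Ring A] [Algebra ℂ A] [StarRing A]
    (M : MeasurableRep α H A)

theorem memLp_meas_vec_iff {x : H} {h g : α → ℂ} (hh : MemLp h 2 (M.meas x)) (hg : Measurable g) :
    MemLp g 2 (M.meas (M.vec x h)) ↔ MemLp (g * h) 2 (M.meas x) := by
  have e : eLpNorm g 2 (M.meas (M.vec x h)) = eLpNorm (g * h) 2 (M.meas x) := by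
    refine (ENNReal.pow_right_strictMono two_ne_zero).injective ?_
    rw [eLpNorm_two_sq, eLpNorm_two_sq, M.meas_vec hh,
      lintegral_withDensity_eq_lintegral_mul₀ (hh.1.enorm.pow_const 2)
        (hg.enorm.pow_const 2).aemeasurable]
    refine lintegral_congr fun a => ?_
    simp only [Pi.mul_apply]
    rw [enorm_mul, mul_pow, mul_comm]
  constructor
  · exact fun h' => ⟨hg.aestronglyMeasurable.mul hh.1, e ▸ h'.2⟩
  · exact fun h' => ⟨hg.aestronglyMeasurable, e.symm ▸ h'.2⟩

theorem integral_meas_vec {x : H} {h : α → ℂ} (hh : MemLp h 2 (M.meas x)) (g : α → ℝ) :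
    ∫ a, g a ∂(M.meas (M.vec x h)) = ∫ a, ‖h a‖ ^ 2 * g a ∂(M.meas x) := by
  rw [M.meas_vec hh, integral_withDensity_eq_integral_toReal_smul₀ (hh.1.enorm.pow_const 2)
    (Filter.Eventually.of_forall fun a => by finiteness)]
  simp

theorem op_indicator_union {S S' : Set α} (hS : MeasurableSet S) (hS' : MeasurableSet S')
    (hd : Disjoint S S') :
    M.op ((S ∪ S').indicator 1) = M.op (S.indicator 1) + M.op (S'.indicator 1) := by
  ext x
  have h1 := IsBddMeas.indicator_one hS
  have h2 := IsBddMeas.indicator_one hS'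
  rw [add_apply, M.op_apply h1, M.op_apply h2,
    M.op_apply (IsBddMeas.indicator_one (hS.union hS')), indicator_union_of_disjoint hd,
    ← M.vec_add (h1.memLp 2 _) (h2.memLp 2 _)]
  rfl

theorem op_indicator_inter {S S' : Set α} (hS : MeasurableSet S) (hS' : MeasurableSet S') :
    M.op ((S ∩ S').indicator 1) = M.op (S.indicator 1) * M.op (S'.indicator 1) := by
  rw [← M.op_mul (IsBddMeas.indicator_one hS) (IsBddMeas.indicator_one hS')]
  congr 1
  ext a
  by_cases ha : a ∈ S <;> by_cases ha' : a ∈ S' <;> simp [ha, ha']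

theorem op_indicator_empty : M.op ((∅ : Set α).indicator 1) = 0 := by
  have := M.op_indicator_union (S := ∅) (S' := ∅) .empty .empty (by simp)
  simpa using this

theorem op_indicator_biUnion {S : ℕ → Set α} (hS : ∀ n, MeasurableSet (S n))
    (hd : Pairwise fun m n => Disjoint (S m) (S n)) (F : Finset ℕ) :
    M.op ((⋃ n ∈ F, S n).indicator 1) = ∑ n ∈ F, M.op ((S n).indicator 1) := by
  classical
  induction F using Finset.induction_on with
  | empty => simpa using M.op_indicator_empty
  | insert n F hn ih =>
    rw [Finset.set_biUnion_insert, M.op_indicator_union (hS n)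
      (Finset.measurableSet_biUnion _ fun m _ => hS m), ih, Finset.sum_insert hn]
    rw [disjoint_iUnion₂_right]
    exact fun m hm => hd fun e => hn (e ▸ hm)

/-- Strong countable additivity. The squared distance to a partial sum is the measure of the
remaining sets, at most a tail of a convergent series. -/
theorem hasSum_op_indicator {S : ℕ → Set α} (hS : ∀ n, MeasurableSet (S n))
    (hd : Pairwise fun m n => Disjoint (S m) (S n)) (x : H) :
    HasSum (fun n => M.op ((S n).indicator 1) x) (M.op ((⋃ n, S n).indicator 1) x) := by
  have hm : ∀ F : Finset ℕ, MeasurableSet (⋃ n ∈ F, S n) := fun F =>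
    Finset.measurableSet_biUnion _ fun n _ => hS n
  have hU : MeasurableSet (⋃ n, S n) := MeasurableSet.iUnion hS
  have hfin : ∑' n, M.meas x (S n) ≠ ⊤ := by
    rw [← measure_iUnion hd hS]
    exact measure_ne_top _ _
  rw [HasSum, tendsto_iff_edist_tendsto_0]
  have key : ∀ F : Finset ℕ, edist (∑ n ∈ F, M.op ((S n).indicator 1) x)
      (M.op ((⋃ n, S n).indicator 1) x) ^ 2 ≤ ∑' n : { n // n ∉ F }, M.meas x (S n) := by
    intro F
    have e := M.op_indicator_union (hm F) (hU.diff (hm F)) disjoint_sdiff_right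
    rw [union_sdiff_cancel (iUnion₂_subset fun n _ => subset_iUnion S n),
      M.op_indicator_biUnion hS hd] at e
    rw [edist_comm, edist_eq_enorm_sub, e, add_apply, sum_apply, add_sub_cancel_left,
      M.enorm_op_indicator_sq (hU.diff (hm F))]
    refine (measure_mono ?_).trans (measure_iUnion_le _)
    rintro a ⟨h1, h2⟩
    obtain ⟨n, hn⟩ := mem_iUnion.1 h1
    exact mem_iUnion.2 ⟨⟨n, fun hF => h2 (mem_iUnion₂.2 ⟨n, hF, hn⟩)⟩, hn⟩
  have h0 := tendsto_of_tendsto_of_tendsto_of_le_of_le tendsto_const_nhds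
    (ENNReal.tendsto_tsum_compl_atTop_zero hfin) (fun _ => zero_le) key
  have h1 := (ENNReal.continuous_rpow_const (y := (1 / 2 : ℝ))).continuousAt.tendsto.comp h0
  rw [ENNReal.zero_rpow_of_pos (by norm_num)] at h1
  refine h1.congr fun F => ?_
  rw [Function.comp_apply, ← ENNReal.rpow_natCast, ← ENNReal.rpow_mul]
  norm_num

open Classical in
/-- The projection-valued measure `S ↦ ∫ 1_{ψ⁻¹ S} dE`, the image of the spectral measure of a
representation under a real function `ψ`. -/
def toProjValuedMeasure {ψ : α → ℝ} (hψ : Measurable ψ) : ProjValuedMeasure H where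
  proj S := if MeasurableSet S then M.op ((ψ ⁻¹' S).indicator 1) else 0
  isStarProjection_proj S hS := by
    rw [if_pos hS]
    refine ⟨?_, M.isSelfAdjoint_op (IsBddMeas.indicator_one (hψ hS)) fun a => ?_⟩
    · rw [IsIdempotentElem, ← M.op_indicator_inter (hψ hS) (hψ hS), inter_self]
    · by_cases ha : a ∈ ψ ⁻¹' S <;> simp [ha]
  proj_empty := by simpa using M.op_indicator_empty
  proj_univ := by simpa using M.op_one
  proj_inter S S' hS hS' := by
    rw [if_pos hS, if_pos hS', if_pos (hS.inter hS'), preimage_inter,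
      M.op_indicator_inter (hψ hS) (hψ hS')]
  hasSum_proj S hS hd x := by
    simp only [hS, MeasurableSet.iUnion hS, if_true, preimage_iUnion]
    exact M.hasSum_op_indicator (fun n => hψ (hS n)) (fun m n h => (hd h).preimage ψ) x

theorem scalar_toProjValuedMeasure {ψ : α → ℝ} (hψ : Measurable ψ) (x : H) :
    (M.toProjValuedMeasure hψ).scalar x = (M.meas x).map ψ := by
  ext S hS
  rw [ProjValuedMeasure.scalar_apply _ x hS, Measure.map_apply hψ hS,
    ← M.enorm_op_indicator_sq (hψ hS), ← ofReal_norm, ENNReal.ofReal_pow (norm_nonneg _)]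
  congr 3
  exact congrArg (fun B : H →L[ℂ] H => B x) (if_pos hS)

end MeasurableRep

theorem Complex.norm_sq_mul_inv_re (z : ℂ) : ‖z‖ ^ 2 * (z⁻¹).re = z.re := by
  by_cases hz : z = 0
  · simp [hz]
  · have : Complex.normSq z ≠ 0 := by simpa using hz
    rw [Complex.inv_re, ← Complex.normSq_eq_norm_sq]
    field_simp

namespace IsSelfAdjoint

variable {H : Type*} [NormedAddCommGroup H] [InnerProductSpace ℂ H] [CompleteSpace H]
  {T : H →ₗ.[ℂ] H} {N : H →L[ℂ] H}

theorem star_resolvent_neg_I (hT : IsSelfAdjoint T) (hN : IsResolventAt T (-Complex.I) N) :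
    IsResolventAt T Complex.I (star N) := by
  obtain ⟨S, hS⟩ := hT.exists_isResolventAt (z := Complex.I) (by simp)
  rwa [IsResolventAt.star_eq hT hN (by simpa using hS)]

theorem sub_star_resolvent (hT : IsSelfAdjoint T) (hN : IsResolventAt T (-Complex.I) N) :
    N - star N = (-(2 * Complex.I)) • (N * star N) := by
  rw [hN.sub_eq (hT.star_resolvent_neg_I hN)]
  congr 1
  ring

theorem isStarNormal_resolvent (hT : IsSelfAdjoint T) (hN : IsResolventAt T (-Complex.I) N) :
    IsStarNormal N := by
  have h1 := hT.sub_star_resolvent hN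
  have h2 := (hT.star_resolvent_neg_I hN).sub_eq hN
  refine ⟨?_⟩
  have h3 : (2 * Complex.I) • (star N * N) = (2 * Complex.I) • (N * star N) := by
    have : (Complex.I - -Complex.I) = 2 * Complex.I := by ring
    rw [this] at h2
    rw [← h2, ← neg_sub, h1, neg_smul, neg_neg]
  exact smul_right_injective _ (by simp : (2 * Complex.I) ≠ 0) h3

/-- The spectrum of `(T + i)⁻¹` lies on the image of the real line under `t ↦ (t + i)⁻¹`. -/
theorem spectrum_resolvent (hT : IsSelfAdjoint T) (hN : IsResolventAt T (-Complex.I) N)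
    (z : spectrum ℂ N) : (z : ℂ).im = -Complex.normSq z := by
  have hn := hT.isStarNormal_resolvent hN
  let u : C(spectrum ℂ N, ℂ) := (ContinuousMap.id ℂ).restrict (spectrum ℂ N)
  have hu : cfcHom hn u = N := cfcHom_id (R := ℂ) hn
  have h : cfcHom hn (u - star u) = cfcHom hn ((-(2 * Complex.I)) • (u * star u)) := by
    rw [map_sub, map_smul, map_mul, map_star, hu, hT.sub_star_resolvent hN]
  have h2 := congrArg (fun f : C(spectrum ℂ N, ℂ) => (f z).im) (cfcHom_injective hn h)
  have h3 : ((z : ℂ) - star (z : ℂ)).im = ((-(2 * Complex.I)) * ((z : ℂ) * star (z : ℂ))).im := h2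
  rw [Complex.star_def, Complex.mul_conj] at h3
  simp at h3
  linarith

theorem inv_im_resolvent (hT : IsSelfAdjoint T) (hN : IsResolventAt T (-Complex.I) N)
    {z : spectrum ℂ N} (hz : (z : ℂ) ≠ 0) : ((z : ℂ)⁻¹).im = 1 := by
  have : Complex.normSq (z : ℂ) ≠ 0 := by simpa using hz
  rw [Complex.inv_im, hT.spectrum_resolvent hN, neg_neg, div_self this]

/-- The spectral theorem for unbounded self-adjoint operators: the image of the spectral measure of
`N = (T + i)⁻¹` under `z ↦ Re z⁻¹` is a spectral measure of `T`. On the spectrum of `N`, apart from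
the point `0`, one has `z⁻¹ = t + i` with `t` real, so `Re z⁻¹` recovers `t`. -/
theorem exists_isSpectralMeasureOf (hT : IsSelfAdjoint T) :
    ∃ P : ProjValuedMeasure H, P.IsSpectralMeasureOf T := by
  obtain ⟨N, hN⟩ := hT.exists_isResolventAt (z := -Complex.I) (by simp)
  have hn := hT.isStarNormal_resolvent hN
  set M := NormalOperator.measurableRep hn with hM
  have hid : IsBddMeas fun z : spectrum ℂ N => (z : ℂ) :=
    M.isBddMeas_toFn ((ContinuousMap.id ℂ).restrict (spectrum ℂ N))
  have hNop : M.op (fun z => (z : ℂ)) = N := NormalOperator.measurableRep_op_id hn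
  have hNapply : ∀ y, N y = M.op (fun z => (z : ℂ)) y := fun y =>
    (congrArg (fun B : H →L[ℂ] H => B y) hNop).symm
  have hNvec : ∀ y, M.vec y (fun z => (z : ℂ)) = N y := fun y => by
    rw [hNapply, ← M.op_apply hid]
  have hinj : ∀ y, N y = 0 → y = 0 := by
    intro y hy
    obtain ⟨h, e⟩ := hN.2 y
    have h0 : (⟨N y, h⟩ : T.domain) = 0 := Subtype.ext hy
    rw [h0, hy] at e
    simpa using e.symm
  have hinv : Measurable fun z : spectrum ℂ N => (z : ℂ)⁻¹ := measurable_subtype_coe.inv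
  have hψ : Measurable fun z : spectrum ℂ N => ((z : ℂ)⁻¹).re := Complex.measurable_re.comp hinv
  have hψc : Measurable fun z : spectrum ℂ N => ((((z : ℂ)⁻¹).re : ℝ) : ℂ) :=
    Complex.measurable_ofReal.comp hψ
  -- `N` is injective, so the point `0`, which stands for `∞`, carries no mass.
  have hne : ∀ x, ∀ᵐ z : spectrum ℂ N ∂(M.meas x), (z : ℂ) ≠ 0 := by
    intro x
    have hS : MeasurableSet {z : spectrum ℂ N | (z : ℂ) = 0} :=
      measurable_subtype_coe (measurableSet_singleton 0)
    have h1 := IsBddMeas.indicator_one hS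
    have h2 : N (M.op ({z : spectrum ℂ N | (z : ℂ) = 0}.indicator 1) x) = 0 := by
      rw [hNapply, ← mul_apply_eq_comp, ← M.op_mul hid h1]
      have e : (fun z : spectrum ℂ N => (z : ℂ)) * {z : spectrum ℂ N | (z : ℂ) = 0}.indicator 1
          = (∅ : Set (spectrum ℂ N)).indicator 1 := by
        ext z
        by_cases hz : (z : ℂ) = 0 <;> simp [hz]
      rw [e, M.op_indicator_empty, zero_apply]
    have h3 := M.enorm_op_indicator_sq hS x
    rw [hinj _ h2] at h3
    rw [ae_iff]
    simpa using h3.symm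
  refine ⟨M.toProjValuedMeasure hψ, fun x => ?_, fun x => ?_⟩
  · rw [M.scalar_toProjValuedMeasure hψ, integrable_map_measure (by fun_prop) hψ.aemeasurable]
    have hiff : Integrable ((fun t : ℝ => t ^ 2) ∘ fun z : spectrum ℂ N => ((z : ℂ)⁻¹).re)
        (M.meas x) ↔ MemLp (fun z : spectrum ℂ N => ((((z : ℂ)⁻¹).re : ℝ) : ℂ)) 2 (M.meas x) := by
      rw [memLp_two_iff_integrable_sq_norm
        hψc.aestronglyMeasurable]
      simp_rw [Complex.norm_real, Real.norm_eq_abs, sq_abs]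
      rfl
    rw [hiff]
    constructor
    · intro hx
      -- `x = N y` has the measure `|z|² μ_y`, and `|z Re z⁻¹| ≤ 1`
      have e : N (T ⟨x, hx⟩ - (-Complex.I) • x) = x := hN.1 ⟨x, hx⟩
      rw [← e, ← hNvec, M.memLp_meas_vec_iff (hid.memLp 2 _) hψc]
      refine MemLp.of_bound
        (hψc.mul measurable_subtype_coe).aestronglyMeasurable 1
        (Filter.Eventually.of_forall fun z => ?_)
      rw [Pi.mul_apply, norm_mul, Complex.norm_real]
      calc _ ≤ ‖(z : ℂ)⁻¹‖ * ‖(z : ℂ)‖ := by gcongr; exact Complex.abs_re_le_norm _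
        _ ≤ 1 := by
          rw [norm_inv]
          exact inv_mul_le_one
    · intro hx
      -- `z⁻¹` is square integrable, and `N` maps the vector `z⁻¹ x` to `x`
      have hmem : MemLp (fun z : spectrum ℂ N => (z : ℂ)⁻¹) 2 (M.meas x) := by
        have h1 : MemLp (fun _ : spectrum ℂ N => Complex.I) 2 (M.meas x) := memLp_const _
        refine (hx.add h1).ae_eq ?_
        filter_upwards [hne x] with z hz
        have := Complex.re_add_im (z : ℂ)⁻¹
        rw [hT.inv_im_resolvent hN hz] at this
        simpa using this
      have e : N (M.vec x fun z => (z : ℂ)⁻¹) = x := by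
        rw [hNapply, M.op_vec hid hmem]
        conv_rhs => rw [← M.vec_one x]
        refine M.vec_congr ?_
        filter_upwards [hne x] with z hz
        simp [hz]
      obtain ⟨h, -⟩ := hN.2 (M.vec x fun z => (z : ℂ)⁻¹)
      rwa [e] at h
  · obtain ⟨y, hy⟩ : ∃ y, N y = x := ⟨_, hN.1 x⟩
    have hTx : T x = y - Complex.I • (x : H) := by
      obtain ⟨h, e⟩ := hN.2 y
      have h0 : (⟨N y, h⟩ : T.domain) = x := Subtype.ext hy
      rw [h0, hy] at e
      rw [← e]
      simp
    have h1 : IsBddMeas (1 : spectrum ℂ N → ℂ) := M.isBddMeas_toFn 1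
    -- with `x = N y`, the claim reads `conj z (1 - i z) = |z|² Re z⁻¹` on the spectrum of `N`
    have hv : T x = M.vec y (1 - Complex.I • fun z : spectrum ℂ N => (z : ℂ)) := by
      rw [M.vec_sub (h1.memLp 2 _) ((hid.memLp 2 _).const_smul _), M.vec_smul _ (hid.memLp 2 _),
        M.vec_one, hNvec, hy, hTx]
    rw [M.scalar_toProjValuedMeasure hψ, integral_map hψ.aemeasurable (by fun_prop), hv]
    conv_lhs => rw [← hy, ← hNvec]
    conv_rhs => rw [← hy, ← hNvec, M.integral_meas_vec (hid.memLp 2 _)]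
    rw [M.inner_vec (hid.memLp 2 _)
      ((h1.memLp 2 _).sub ((hid.memLp 2 _).const_smul Complex.I)), ← integral_complex_ofReal]
    refine integral_congr_ae (Filter.Eventually.of_forall fun z => ?_)
    dsimp only
    rw [Complex.norm_sq_mul_inv_re]
    have h2 := hT.spectrum_resolvent hN z
    rw [Complex.normSq_apply] at h2
    apply Complex.ext <;> simp <;> linarith

theorem isSpectralMeasureOf_spectralMeasure (hT : IsSelfAdjoint T) :
    (spectralMeasure T).IsSpectralMeasureOf T := by
  rw [spectralMeasure, dif_pos hT.exists_isSpectralMeasureOf]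
  exact hT.exists_isSpectralMeasureOf.choose_spec

end IsSelfAdjoint

/-! ### Calculus with the spectral measure -/

/-- On a dense domain, a linear map with vanishing quadratic form vanishes. -/
theorem LinearMap.eq_zero_of_inner_self {H : Type*} [NormedAddCommGroup H] [InnerProductSpace ℂ H]
    {D : Submodule ℂ H} (hD : Dense (D : Set H)) (C : D →ₗ[ℂ] H)
    (h : ∀ x : D, inner ℂ (x : H) (C x) = 0) : C = 0 := by
  ext x
  refine hD.eq_zero_of_inner_right ℂ fun v hv => ?_
  lift v to D using hv
  -- polarization with `x + v` and `x + i v`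
  have h1 := h (x + v)
  have h2 := h (x + Complex.I • v)
  simp only [map_add, map_smul, Submodule.coe_add, Submodule.coe_smul, inner_add_left,
    inner_add_right, inner_smul_left, inner_smul_right, h, Complex.conj_I] at h1 h2
  have h3 : (2 * Complex.I) * inner ℂ (v : H) (C x) = 0 := by
    linear_combination Complex.I * h1 - h2
  simpa using h3

namespace ProjValuedMeasure.IsSpectralMeasureOf

variable {H : Type*} [NormedAddCommGroup H] [InnerProductSpace ℂ H] [CompleteSpace H]
  {T : H →ₗ.[ℂ] H} {P : ProjValuedMeasure H}

theorem mem_domain_iff (hP : P.IsSpectralMeasureOf T) (x : H) :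
    x ∈ T.domain ↔ MemLp (fun t : ℝ => (t : ℂ)) 2 (P.measurableRep.meas x) := by
  rw [hP.1 x, memLp_two_iff_integrable_sq_norm (by fun_prop)]
  simp_rw [Complex.norm_real, Real.norm_eq_abs, sq_abs]
  rfl

/-- The quadratic form in the definition of a spectral measure determines `T` by polarization, so
`T x` is the integral of `t` at `x`. -/
theorem apply_eq_vec (hP : P.IsSpectralMeasureOf T) (hT : IsSelfAdjoint T) (x : T.domain) :
    T x = P.measurableRep.vec x fun t => (t : ℂ) := by
  set M := P.measurableRep with hM
  have hm : ∀ x : T.domain, MemLp (fun t : ℝ => (t : ℂ)) 2 (M.meas x) := fun x =>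
    (hP.mem_domain_iff x).1 x.2
  let L : T.domain →ₗ[ℂ] H :=
    { toFun := fun x => M.vec x fun t => (t : ℂ)
      map_add' := fun x y => M.vec_add_left (hm x) (hm y) (hm (x + y))
      map_smul' := fun c x => M.vec_smul_left c (hm x) (hm (c • x)) }
  have h := LinearMap.eq_zero_of_inner_self hT.dense_domain (T.toFun - L) fun x => by
    rw [LinearMap.sub_apply, inner_sub_right, sub_eq_zero]
    refine (hP.2 x).trans (Eq.symm ?_)
    refine (M.inner_vec_right (hm x)).trans ?_
    exact integral_complex_ofReal
  exact sub_eq_zero.1 (congrArg (fun C : T.domain →ₗ[ℂ] H => C x) h)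

theorem sub_smul_eq_vec (hP : P.IsSpectralMeasureOf T) (hT : IsSelfAdjoint T) (z : ℂ)
    (x : T.domain) : T x - z • (x : H) = P.measurableRep.vec x fun t => (t : ℂ) - z := by
  have hm := (hP.mem_domain_iff x).1 x.2
  have h1 : MemLp (1 : ℝ → ℂ) 2 (P.measurableRep.meas x) := memLp_const 1
  have e : (fun t : ℝ => (t : ℂ) - z) = (fun t : ℝ => (t : ℂ)) - z • (1 : ℝ → ℂ) := by
    ext t; simp
  rw [e, P.measurableRep.vec_sub hm (h1.const_smul z), P.measurableRep.vec_smul z h1,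
    P.measurableRep.vec_one, hP.apply_eq_vec hT]

end ProjValuedMeasure.IsSpectralMeasureOf

theorem abs_im_le_norm_ofReal_sub (z : ℂ) (t : ℝ) : |z.im| ≤ ‖(t : ℂ) - z‖ := by
  have := Complex.abs_im_le_norm ((t : ℂ) - z)
  simpa using this

theorem isBddMeas_inv_sub {z : ℂ} (hz : z.im ≠ 0) : IsBddMeas fun t : ℝ => ((t : ℂ) - z)⁻¹ := by
  refine ⟨by fun_prop, |z.im|⁻¹, fun t => ?_⟩
  rw [norm_inv]
  exact inv_anti₀ (abs_pos.2 hz) (abs_im_le_norm_ofReal_sub z t)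

namespace ProjValuedMeasure.IsSpectralMeasureOf

variable {H : Type*} [NormedAddCommGroup H] [InnerProductSpace ℂ H] [CompleteSpace H]
  {T : H →ₗ.[ℂ] H} {P : ProjValuedMeasure H}

/-- The resolvent is the integral of `(t - z)⁻¹`. -/
theorem op_inv_sub_eq (hP : P.IsSpectralMeasureOf T) (hT : IsSelfAdjoint T) {z : ℂ}
    (hz : z.im ≠ 0) {R : H →L[ℂ] H} (hR : IsResolventAt T z R) :
    P.measurableRep.op (fun t => ((t : ℂ) - z)⁻¹) = R := by
  ext y
  obtain ⟨h, e⟩ := hR.2 y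
  have h1 := hP.sub_smul_eq_vec hT z ⟨R y, h⟩
  rw [e] at h1
  have hm : MemLp (fun t : ℝ => (t : ℂ) - z) 2 (P.measurableRep.meas (R y)) :=
    ((hP.mem_domain_iff _).1 h).sub (memLp_const z)
  conv_lhs => rw [h1]
  rw [P.measurableRep.op_vec (isBddMeas_inv_sub hz) hm]
  refine Eq.trans ?_ (P.measurableRep.vec_one _)
  congr 1
  ext t
  have h2 : (t : ℂ) - z ≠ 0 := by
    have h3 := abs_im_le_norm_ofReal_sub z t
    have h4 := abs_pos.2 hz
    exact norm_pos_iff.1 (h4.trans_le h3)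
  simp [h2]

/-- Vectors whose spectral measure is concentrated near a point `t₀` are almost eigenvectors, so
there are none but `0` if `T - t₀` has a bounded inverse. -/
theorem scalar_ball_eq_zero (hP : P.IsSpectralMeasureOf T) (hT : IsSelfAdjoint T) {t₀ : ℝ}
    {R : H →L[ℂ] H} (hR : IsResolventAt T t₀ R) (w : H) :
    P.scalar w (Metric.ball t₀ (‖R‖ + 1)⁻¹) = 0 := by
  set ε := (‖R‖ + 1)⁻¹ with hε
  have hε0 : 0 < ε := by positivity
  set M := P.measurableRep with hM
  set x := P.proj (Metric.ball t₀ ε) w with hx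
  have hμ : M.meas x = (P.scalar w).restrict (Metric.ball t₀ ε) :=
    P.scalar_proj measurableSet_ball w
  have hae : ∀ᵐ t ∂(M.meas x), |t - t₀| ≤ ε := by
    rw [hμ]
    filter_upwards [ae_restrict_mem measurableSet_ball] with t ht
    exact (Metric.mem_ball.1 ht).le
  have hxD : x ∈ T.domain := by
    refine (hP.mem_domain_iff x).2 (MemLp.of_bound (by fun_prop) (|t₀| + ε) ?_)
    filter_upwards [hae] with t ht
    rw [Complex.norm_real, Real.norm_eq_abs]
    have := abs_sub_abs_le_abs_sub t t₀
    linarith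
  have h1 := hP.sub_smul_eq_vec hT t₀ ⟨x, hxD⟩
  have h2 : ‖T ⟨x, hxD⟩ - (t₀ : ℂ) • x‖ ≤ ε * ‖x‖ := by
    refine le_of_sq_le_sq ?_ (by positivity)
    have hm : MemLp (fun t : ℝ => (t : ℂ) - t₀) 2 (M.meas x) :=
      ((hP.mem_domain_iff x).1 hxD).sub (memLp_const _)
    rw [h1, M.norm_vec_sq hm]
    have h3 : ∀ᵐ t : ℝ ∂(M.meas x), ‖‖(t : ℂ) - t₀‖ ^ 2‖ ≤ ε ^ 2 := by
      filter_upwards [hae] with t ht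
      rw [norm_pow, norm_norm, ← Complex.ofReal_sub, Complex.norm_real, Real.norm_eq_abs]
      gcongr
    have h4 := (le_abs_self _).trans (norm_integral_le_of_norm_le_const h3)
    rw [Measure.real, M.measure_univ_meas] at h4
    refine h4.trans (le_of_eq ?_)
    simp [mul_pow]
  have h3 : ‖x‖ ≤ ‖R‖ * (ε * ‖x‖) := by
    have h6 : R (T ⟨x, hxD⟩ - (t₀ : ℂ) • x) = x := hR.1 ⟨x, hxD⟩
    calc ‖x‖ = ‖R (T ⟨x, hxD⟩ - (t₀ : ℂ) • x)‖ := by rw [h6]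
      _ ≤ _ := (R.le_opNorm _).trans (by gcongr)
  have h4 : ‖R‖ * ε < 1 := by
    rw [hε, ← div_eq_mul_inv, div_lt_one (by positivity)]
    linarith
  have h5 : ‖x‖ = 0 := by
    by_contra h6
    have h7 : 0 < ‖x‖ := lt_of_le_of_ne (norm_nonneg x) (Ne.symm h6)
    nlinarith
  rw [P.scalar_apply w measurableSet_ball, ← hx, h5]
  simp

theorem ae_mem_realSpectrum (hP : P.IsSpectralMeasureOf T) (hT : IsSelfAdjoint T) (w : H) :
    ∀ᵐ t ∂(P.scalar w), t ∈ realSpectrum T := by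
  change P.scalar w (realSpectrum T)ᶜ = 0
  refine measure_null_of_locally_null _ fun t ht => ?_
  obtain ⟨R, hR⟩ : ∃ R : H →L[ℂ] H, IsResolventAt T t R := not_not.1 ht
  exact ⟨_, mem_nhdsWithin_of_mem_nhds (Metric.ball_mem_nhds t (by positivity)),
    hP.scalar_ball_eq_zero hT hR w⟩

end ProjValuedMeasure.IsSpectralMeasureOf

theorem inv_norm_sub_mem_contPlus {z : ℂ} (hz : z.im ≠ 0) (σ : Set ℝ) :
    (fun t : ℝ => ‖(t : ℂ) - z‖⁻¹) ∈ ContPlus σ := by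
  have h0 : ∀ t : ℝ, 0 < ‖(t : ℂ) - z‖ := fun t =>
    (abs_pos.2 hz).trans_le (abs_im_le_norm_ofReal_sub z t)
  refine ⟨Continuous.continuousOn ?_, fun t _ => inv_pos.2 (h0 t), ⟨|z.im|⁻¹, ?_⟩,
    (1 + ‖z‖)⁻¹, by positivity, fun t _ ht => ?_⟩
  · exact Continuous.inv₀ (by fun_prop) fun t => (h0 t).ne'
  · rintro _ ⟨t, -, rfl⟩
    exact inv_anti₀ (abs_pos.2 hz) (abs_im_le_norm_ofReal_sub z t)
  · rw [← div_eq_mul_inv, inv_eq_one_div, div_le_div_iff₀ (by positivity) (h0 t)]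
    have h1 := norm_sub_le (t : ℂ) z
    rw [Complex.norm_real, Real.norm_eq_abs] at h1
    nlinarith [norm_nonneg z]

theorem IsCompact.exists_pos_forall_le {Q : Set ℝ} (hQ : IsCompact Q) {h : ℝ → ℝ}
    (hc : ContinuousOn h Q) (hp : ∀ t ∈ Q, 0 < h t) : ∃ δ, 0 < δ ∧ ∀ t ∈ Q, δ ≤ h t := by
  rcases Q.eq_empty_or_nonempty with rfl | hne
  · exact ⟨1, one_pos, by simp⟩
  · obtain ⟨t, ht, hmin⟩ := hQ.exists_isMinOn hne hc
    exact ⟨h t, hp t ht, fun s hs => hmin hs⟩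

section Calculus

variable {H : Type*} [NormedAddCommGroup H] [InnerProductSpace ℂ H] [CompleteSpace H]
  {T : H →ₗ.[ℂ] H}

theorem isBddMeas_of_contPlus {σ : Set ℝ} (hσ : IsClosed σ) {f : ℝ → ℝ} (hf : f ∈ ContPlus σ) :
    IsBddMeas fun t => ((σ.indicator f t : ℝ) : ℂ) := by
  classical
  obtain ⟨hc, hpos, ⟨C, hC⟩, -⟩ := hf
  have hm : Measurable (σ.indicator f) := by
    rw [← piecewise_eq_indicator]
    exact hc.measurable_piecewise continuousOn_const hσ.measurableSet
  refine ⟨Complex.measurable_ofReal.comp hm, |C|, fun t => ?_⟩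
  rw [Complex.norm_real]
  by_cases ht : t ∈ σ
  · rw [indicator_of_mem ht, Real.norm_eq_abs, abs_of_pos (hpos t ht)]
    exact (hC ⟨t, ht, rfl⟩).trans (le_abs_self C)
  · rw [indicator_of_notMem ht, norm_zero]; positivity

/-- The function is cut off outside the spectrum, where its values are arbitrary and it need not
be measurable. -/
theorem functionOf_eq_op {f : ℝ → ℝ}
    (hf : f ∈ ContPlus (realSpectrum T)) :
    functionOf T f = (spectralMeasure T).measurableRep.op
      fun t => (((realSpectrum T).indicator f t : ℝ) : ℂ) := by
  have hσ := isClosed_realSpectrum T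
  have hb := isBddMeas_of_contPlus hσ hf
  have h : IsFunctionOf T f ((spectralMeasure T).measurableRep.op
      fun t => (((realSpectrum T).indicator f t : ℝ) : ℂ)) := by
    intro x
    have hm := hb.memLp 1 ((spectralMeasure T).scalar x)
    constructor
    · rw [← integrable_indicator_iff hσ.measurableSet]
      exact (memLp_one_iff_integrable.1 hm).re
    · rw [MeasurableRep.op_apply _ hb, MeasurableRep.inner_vec_right _ (hb.memLp 2 _),
        ← integral_indicator hσ.measurableSet]
      exact integral_complex_ofReal
  have h' : ∃ A : H →L[ℂ] H, IsFunctionOf T f A := ⟨_, h⟩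
  rw [functionOf, dif_pos h']
  exact h'.choose_spec.unique h

theorem norm_functionOf_sq (hT : IsSelfAdjoint T) {f : ℝ → ℝ}
    (hf : f ∈ ContPlus (realSpectrum T)) (x : H) :
    Integrable (fun t => f t ^ 2) ((spectralMeasure T).scalar x) ∧
      ‖functionOf T f x‖ ^ 2 = ∫ t, f t ^ 2 ∂((spectralMeasure T).scalar x) := by
  have hb := isBddMeas_of_contPlus (isClosed_realSpectrum T) hf
  have e : (fun t => ‖(((realSpectrum T).indicator f t : ℝ) : ℂ)‖ ^ 2)
      =ᵐ[(spectralMeasure T).scalar x] fun t => f t ^ 2 := by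
    filter_upwards [hT.isSpectralMeasureOf_spectralMeasure.ae_mem_realSpectrum hT x] with t ht
    rw [indicator_of_mem ht, Complex.norm_real, Real.norm_eq_abs, sq_abs]
  refine ⟨((hb.memLp 2 _).integrable_norm_pow two_ne_zero).congr e, ?_⟩
  rw [functionOf_eq_op hf, MeasurableRep.op_apply _ hb,
    MeasurableRep.norm_vec_sq _ (hb.memLp 2 _)]
  exact integral_congr_ae e

theorem norm_resolventOp_sq (hT : IsSelfAdjoint T) {z : ℂ} (hz : z.im ≠ 0) (x : H) :
    Integrable (fun t : ℝ => ‖(t : ℂ) - z‖⁻¹ ^ 2) ((spectralMeasure T).scalar x) ∧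
      ‖resolventOp T z x‖ ^ 2 = ∫ t : ℝ, ‖(t : ℂ) - z‖⁻¹ ^ 2 ∂((spectralMeasure T).scalar x) := by
  have hb := isBddMeas_inv_sub hz
  obtain ⟨R, hR⟩ := hT.exists_isResolventAt hz
  have h1 := (hb.memLp 2 ((spectralMeasure T).scalar x)).integrable_norm_pow two_ne_zero
  simp only [norm_inv] at h1
  refine ⟨h1, ?_⟩
  rw [resolventOp_eq hR, ← hT.isSpectralMeasureOf_spectralMeasure.op_inv_sub_eq hT hz hR,
    MeasurableRep.op_apply _ hb, MeasurableRep.norm_vec_sq _ (hb.memLp 2 _)]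
  simp only [norm_inv]
  rfl

theorem measureReal_univ_scalar (P : ProjValuedMeasure H) (x : H) :
    (P.scalar x).real univ = ‖x‖ ^ 2 := by
  have := P.measurableRep.measure_univ_meas x
  rw [Measure.real]
  change (P.measurableRep.meas x univ).toReal = _
  rw [this]
  simp

theorem norm_functionOf_inv_norm_sub_comp {K : Type*} [NormedAddCommGroup K]
    [InnerProductSpace ℂ K] (V : K →L[ℂ] H) {lam : ℂ} (hT : IsSelfAdjoint T) (hlam : lam.im ≠ 0) :
    ‖functionOf T (fun t : ℝ => ‖(t : ℂ) - lam‖⁻¹) ∘L V‖ = ‖resolventOp T lam ∘L V‖ := by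
  have h : ∀ x, ‖(functionOf T (fun t : ℝ => ‖(t : ℂ) - lam‖⁻¹) ∘L V) x‖
      = ‖(resolventOp T lam ∘L V) x‖ := by
    intro x
    rw [← sq_eq_sq₀ (norm_nonneg _) (norm_nonneg _)]
    exact (norm_functionOf_sq hT (inv_norm_sub_mem_contPlus hlam _) (V x)).2.trans
      (norm_resolventOp_sq hT hlam (V x)).2.symm
  refine le_antisymm ?_ ?_
  · refine ContinuousLinearMap.opNorm_le_bound _ (norm_nonneg _) fun x => ?_
    rw [h]
    exact ContinuousLinearMap.le_opNorm _ x
  · refine ContinuousLinearMap.opNorm_le_bound _ (norm_nonneg _) fun x => ?_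
    rw [← h]
    exact ContinuousLinearMap.le_opNorm _ x

variable {K : Type*} [NormedAddCommGroup K] [InnerProductSpace ℂ K] [CompleteSpace K]

theorem exists_isOpen_of_notMem_spectrumAlong {V : K →L[ℂ] H} {t : ℝ}
    (ht : t ∉ spectrumAlong T V) : ∃ U : Set ℝ, IsOpen U ∧ t ∈ U ∧
      (ContinuousLinearMap.adjoint V) ∘L ((spectralMeasure T).proj U) ∘L V = 0 := by
  rw [spectrumAlong, mem_ofPred_eq] at ht
  push Not at ht
  exact ht

theorem isClosed_spectrumAlong (T : H →ₗ.[ℂ] H) (V : K →L[ℂ] H) :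
    IsClosed (spectrumAlong T V) := by
  rw [← isOpen_compl_iff, isOpen_iff_forall_mem_open]
  intro t ht
  obtain ⟨U, hU, htU, h0⟩ := exists_isOpen_of_notMem_spectrumAlong ht
  exact ⟨U, fun s hs h => h U hU hs h0, hU, htU⟩

/-- The measures of the vectors `V x` live on the support `σ_V(T)`, by the Lindelöf property of the
line. -/
theorem ae_mem_spectrumAlong (T : H →ₗ.[ℂ] H) (V : K →L[ℂ] H) (x : K) :
    ∀ᵐ t ∂((spectralMeasure T).scalar (V x)), t ∈ spectrumAlong T V := by
  change (spectralMeasure T).scalar (V x) (spectrumAlong T V)ᶜ = 0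
  refine measure_null_of_locally_null _ fun t ht => ?_
  obtain ⟨U, hU, htU, h0⟩ := exists_isOpen_of_notMem_spectrumAlong ht
  refine ⟨U, mem_nhdsWithin_of_mem_nhds (hU.mem_nhds htU), ?_⟩
  have h1 := (spectralMeasure T).inner_proj hU.measurableSet (V x)
  have h2 := congrArg (fun B : K →L[ℂ] K => inner ℂ x (B x)) h0
  simp only [ContinuousLinearMap.comp_apply, ContinuousLinearMap.adjoint_inner_right,
    zero_apply, inner_zero_right] at h2
  rw [h1, Complex.ofReal_eq_zero] at h2
  rw [(spectralMeasure T).scalar_apply _ hU.measurableSet, h2, ENNReal.ofReal_zero]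

end Calculus

section Main

variable {H₁ H₂ : Type*}
    [NormedAddCommGroup H₁] [InnerProductSpace ℂ H₁] [CompleteSpace H₁]
    [NormedAddCommGroup H₂] [InnerProductSpace ℂ H₂] [CompleteSpace H₂]
    {T : H₁ →ₗ.[ℂ] H₁} (V : H₂ →L[ℂ] H₁) {lam : ℂ}

/-- If `λ` avoids all the balls belonging to `f`, the strict inequality survives the supremum over
unit vectors because mass far out contributes little to the resolvent. -/
theorem norm_resolventOp_comp_lt_one (hT : IsSelfAdjoint T) (hlam : lam.im ≠ 0) {f : ℝ → ℝ}
    (hf : f ∈ ContPlus (realSpectrum T))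
    (h : ∀ t ∈ spectrumAlong T V, (f t)⁻¹ * ‖functionOf T f ∘L V‖ < ‖(t : ℂ) - lam‖) :
    ‖resolventOp T lam ∘L V‖ < 1 := by
  set n := ‖functionOf T f ∘L V‖ with hn
  have hn0 : 0 ≤ n := norm_nonneg _
  have h0 : ∀ t : ℝ, 0 < ‖(t : ℂ) - lam‖ := fun t =>
    (abs_pos.2 hlam).trans_le (abs_im_le_norm_ofReal_sub lam t)
  have hkey : ∀ t ∈ spectrumAlong T V ∩ realSpectrum T,
      0 < f t ^ 2 - n ^ 2 * ‖(t : ℂ) - lam‖⁻¹ ^ 2 := by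
    intro t ht
    have h1 := h t ht.1
    have hft := hf.2.1 t ht.2
    rw [inv_mul_lt_iff₀ hft] at h1
    rw [sub_pos, ← mul_pow]
    refine pow_lt_pow_left₀ ?_ (by positivity) two_ne_zero
    rwa [← div_eq_mul_inv, div_lt_iff₀ (h0 t)]
  -- For `|t| > r` one has `|t - λ|⁻² ≤ (2 w)⁻²`, and `(2 w)⁻² ‖V x‖² ≤ ‖x‖² / 4`.
  set w := ‖V‖ + 1 with hw
  have hw0 : 0 < w := by positivity
  set r := ‖lam‖ + 2 * w with hr
  have hclosed : IsClosed (spectrumAlong T V ∩ realSpectrum T) :=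
    (isClosed_spectrumAlong T V).inter (isClosed_realSpectrum T)
  obtain ⟨δ, hδ, hδle⟩ :=
    ((isCompact_Icc (a := -r) (b := r)).inter_left hclosed).exists_pos_forall_le
    (h := fun t => f t ^ 2 - n ^ 2 * ‖(t : ℂ) - lam‖⁻¹ ^ 2)
    (by
      refine ContinuousOn.sub ((hf.1.mono fun t ht => ht.1.2).pow 2) (Continuous.continuousOn ?_)
      exact continuous_const.mul ((Continuous.inv₀ (by fun_prop) fun t => (h0 t).ne').pow 2))
    (fun t ht => hkey t ht.1)
  set C := |lam.im|⁻¹ ^ 2 with hC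
  have hC0 : 0 < C := by have := abs_pos.2 hlam; positivity
  -- Eliminate the mass of `[-r, r]` from `n² ‖R V x‖² + δ μ[-r, r] ≤ n² ‖x‖²` and
  -- `‖R V x‖² ≤ C μ[-r, r] + ‖x‖² / 4`, where `R` is the resolvent.
  have hbound : ∀ x : H₂, ‖resolventOp T lam (V x)‖ ^ 2 * (δ + C * n ^ 2)
      ≤ (C * n ^ 2 + δ / 4) * ‖x‖ ^ 2 := by
    intro x
    set μ := (spectralMeasure T).scalar (V x) with hμ
    obtain ⟨hRi, hR⟩ := norm_resolventOp_sq hT hlam (V x)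
    obtain ⟨hfi, hfe⟩ := norm_functionOf_sq hT hf (V x)
    have hK : MeasurableSet (Icc (-r) r) := measurableSet_Icc
    have hind : ∀ c : ℝ, Integrable ((Icc (-r) r).indicator fun _ => c) μ := fun c =>
      (integrable_const c).indicator hK
    have hindint : ∀ c : ℝ, ∫ t, (Icc (-r) r).indicator (fun _ => c) t ∂μ
        = c * μ.real (Icc (-r) r) := fun c => by
      rw [integral_indicator_const c hK, smul_eq_mul, mul_comm]
    have h1 : n ^ 2 * ‖resolventOp T lam (V x)‖ ^ 2 + δ * μ.real (Icc (-r) r)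
        ≤ ‖functionOf T f (V x)‖ ^ 2 := by
      rw [hR, hfe, ← integral_const_mul, ← hindint, ← integral_add (hRi.const_mul _) (hind δ)]
      refine integral_mono_ae ((hRi.const_mul _).add (hind δ)) hfi ?_
      filter_upwards [ae_mem_spectrumAlong T V x,
        hT.isSpectralMeasureOf_spectralMeasure.ae_mem_realSpectrum hT (V x)] with t ht1 ht2
      by_cases ht : t ∈ Icc (-r) r
      · have := hδle t ⟨⟨ht1, ht2⟩, ht⟩
        simp only [indicator_of_mem ht]
        linarith
      · have := hkey t ⟨ht1, ht2⟩
        simp only [indicator_of_notMem ht]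
        linarith
    have h2 : ‖resolventOp T lam (V x)‖ ^ 2
        ≤ C * μ.real (Icc (-r) r) + (2 * w)⁻¹ ^ 2 * ‖V x‖ ^ 2 := by
      rw [hR, ← hindint, ← measureReal_univ_scalar (spectralMeasure T) (V x)]
      have hc : ∫ _, (2 * w)⁻¹ ^ 2 ∂μ = (2 * w)⁻¹ ^ 2 * μ.real univ := by
        rw [integral_const, smul_eq_mul, mul_comm]
      rw [← hc, ← integral_add (hind C) (integrable_const _)]
      refine integral_mono hRi ((hind C).add (integrable_const _)) fun t => ?_
      dsimp only
      by_cases ht : t ∈ Icc (-r) r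
      · rw [indicator_of_mem ht]
        refine le_add_of_le_of_nonneg ?_ (by positivity)
        exact pow_le_pow_left₀ (by positivity)
          (inv_anti₀ (abs_pos.2 hlam) (abs_im_le_norm_ofReal_sub lam t)) 2
      · rw [indicator_of_notMem ht, zero_add]
        have h3 : r < |t| := by
          rw [mem_Icc, ← abs_le] at ht
          exact not_le.1 ht
        have h4 := norm_sub_norm_le (t : ℂ) lam
        rw [Complex.norm_real, Real.norm_eq_abs] at h4
        exact pow_le_pow_left₀ (by positivity) (inv_anti₀ (by positivity) (by linarith)) 2
    have h3 : ‖functionOf T f (V x)‖ ^ 2 ≤ n ^ 2 * ‖x‖ ^ 2 := by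
      rw [← mul_pow]
      exact pow_le_pow_left₀ (norm_nonneg _) ((functionOf T f ∘L V).le_opNorm x) 2
    have h4 : (2 * w)⁻¹ ^ 2 * ‖V x‖ ^ 2 ≤ 1 / 4 * ‖x‖ ^ 2 := by
      have h5 : ‖V x‖ ≤ w * ‖x‖ := (V.le_opNorm x).trans (by gcongr; linarith)
      calc (2 * w)⁻¹ ^ 2 * ‖V x‖ ^ 2 ≤ (2 * w)⁻¹ ^ 2 * (w * ‖x‖) ^ 2 := by gcongr
        _ = 1 / 4 * ‖x‖ ^ 2 := by field_simp; ring
    have h5 : C * (n ^ 2 * ‖resolventOp T lam (V x)‖ ^ 2 + δ * μ.real (Icc (-r) r))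
        ≤ C * (n ^ 2 * ‖x‖ ^ 2) := by
      gcongr
      exact h1.trans h3
    have h6 : δ * ‖resolventOp T lam (V x)‖ ^ 2
        ≤ δ * (C * μ.real (Icc (-r) r) + 1 / 4 * ‖x‖ ^ 2) := by
      gcongr
      linarith
    linarith
  set q := (C * n ^ 2 + δ / 4) / (δ + C * n ^ 2) with hq
  have hden : 0 < δ + C * n ^ 2 := by positivity
  have hq1 : q < 1 := by
    rw [hq, div_lt_one hden]
    linarith
  have hq0 : 0 ≤ q := by positivity
  have hle : ‖resolventOp T lam ∘L V‖ ≤ Real.sqrt q := by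
    refine ContinuousLinearMap.opNorm_le_bound _ (Real.sqrt_nonneg q) fun x => ?_
    refine le_of_sq_le_sq ?_ (by positivity)
    rw [mul_pow, Real.sq_sqrt hq0, hq, div_mul_eq_mul_div, le_div_iff₀ hden]
    exact hbound x
  refine hle.trans_lt ?_
  rw [Real.sqrt_lt' one_pos]
  simpa using hq1

end Main

end

theorem proposition4p6 {H₁ H₂ : Type*}
    [NormedAddCommGroup H₁] [InnerProductSpace ℂ H₁] [CompleteSpace H₁]
    [NormedAddCommGroup H₂] [InnerProductSpace ℂ H₂] [CompleteSpace H₂]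
    (T : H₁ →ₗ.[ℂ] H₁) (hT : IsSelfAdjoint T) (V : H₂ →L[ℂ] H₁)
    (lam : ℂ) (hlam : lam.im ≠ 0) :
    1 ≤ ‖(resolventOp T lam) ∘L V‖ ↔
      ∀ f ∈ ContPlus (realSpectrum T),
        lam ∈ ⋃ t ∈ spectrumAlong T V,
          Metric.closedBall (t : ℂ) ((f t)⁻¹ * ‖(functionOf T f) ∘L V‖) := by
  constructor
  · intro ha f hf
    by_contra hnot
    refine absurd ha (not_le.2 (norm_resolventOp_comp_lt_one V hT hlam hf fun t ht => ?_))
    simp only [mem_iUnion, exists_prop, not_exists, not_and, Metric.mem_closedBall, not_le] at hnot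
    have := hnot t ht
    rwa [dist_comm, dist_eq_norm] at this
  · intro hb
    have h := hb _ (inv_norm_sub_mem_contPlus hlam _)
    simp only [mem_iUnion, exists_prop, Metric.mem_closedBall] at h
    obtain ⟨t, -, ht⟩ := h
    have h0 : 0 < ‖(t : ℂ) - lam‖ :=
      (abs_pos.2 hlam).trans_le (abs_im_le_norm_ofReal_sub lam t)
    rw [norm_functionOf_inv_norm_sub_comp V hT hlam, inv_inv, dist_comm, dist_eq_norm] at ht
    exact le_of_mul_le_mul_left (by rwa [mul_one]) h0
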